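/- Equip $SO(3)$ with the Riemannian metric $\langle RA,RB\rangle=\tfrac12\operatorname{tr}(A^TB)$ ($A,B$ skew-symmetric), with geodesic distance $d(R,Q)=\arccos\frac{\operatorname{tr}(R^TQ)-1}{2}$ and gradient $\nabla$. Let $0<\varepsilon<\pi/2$ and $\mathcal D_\varepsilon=\{R\in SO(3): d(I,R)<\frac{\pi}{2}-\varepsilon\}$, and let $\mathcal P(\mathcal D_\varepsilon)$ be the set of Borel probability measures on $\mathcal D_\varepsilon$ with the intrinsic $1$-Wasserstein distance $W_1$ (cost $d$). Let $K(R,Q)=g(d(R,Q)^2)$ for all $R,Q\in SO(3)$, where $g:[0,\infty)\to\mathbb R$ is differentiable with locally Lipschitz continuous derivative. For $T\in(0,\infty]$, a family $(\rho_t)_{t\in[0,T)}\subset\mathcal P(\mathcal D_\varepsilon)$ is a weak solution of $\partial_t\rho+\nabla\cdot(\rho v)=0$, $v=-\nabla K*\rho$, if the field $v[\rho](R,t)=-\int\nabla K_Q(R)\,d\rho_t(Q)$, where $K_Q(R)=K(R,Q)$, generates a unique flow map $\Psi:\operatorname{supp}(\rho_0)\times[0,T)\to\mathcal D_\varepsilon$,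 that is, $\frac{d}{dt}\Psi^t(R)=v[\rho](\Psi^t(R),t)$ and $\Psi^0(R)=R$, and $\rho_t=\Psi^t\#\rho_0$ for all $t\in[0,T)$. Put $f(\theta)=\theta/\sin\theta$, $f(0)=1$; let $C_f$ and $L_f$ be the suprema of $f$ and $f'$ on $[0,\pi-2\varepsilon]$, and let $C_{g'}$ and $L_{g'}$ be the supremum of $|g'|$ and the least Lipschitz constant of $g'$ on $[0,(\pi-2\varepsilon)^2]$. Set $$L=4\sqrt2\,\pi^2L_{g'}+2\sqrt3\,C_{g'}(L_f+\sqrt2\,C_f),\qquad \mathrm{Lip}=\tfrac1{\sqrt2}\bigl(4\sqrt2\,\pi^2L_{g'}+2C_{g'}(\sqrt3\,L_f+\sqrt2\,C_f)\bigr),$$ $$r(\varepsilon,t)=\exp\Bigl(\Bigl(\mathrm{Lip}+2\sqrt6\,\pi\,\frac{\tan(\pi/2-\varepsilon)}{\pi/2-\varepsilon}\,C_{g'}+\frac{L}{\sqrt2}\Bigr)t\Bigr).$$ **Theorem (Stability).** One has $r(\varepsilon,0)=1$, and $r(\varepsilon,\cdot)$ is nondecreasing, and strictly increasing unless $g'$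 vanishes identically on $[0,(\pi-2\varepsilon)^2]$. For all $T\in(0,\infty]$ and all weak solutions $\rho,\sigma$ on $[0,T)$ in $\mathcal P(\mathcal D_\varepsilon)$, starting from $\rho_0,\sigma_0\in\mathcal P(\mathcal D_\varepsilon)$, there exists $T^*\in(0,T)$ such that $r(\varepsilon,\cdot)$ is bounded on $[0,T^*)$ and $$W_1(\rho_t,\sigma_t)\le r(\varepsilon,t)\,W_1(\rho_0,\sigma_0)\qquad\text{for all } t\in[0,T^*).$$ -/

import Mathlib

open MeasureTheory Set

/-! ### The rotation group as a Riemannian manifold -/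

/-- The rotation group `SO(3)`, with the topology induced from the space of `3 × 3` matrices. -/
abbrev SO3 : Type := Matrix.specialOrthogonalGroup (Fin 3) ℝ

instance instMeasurableSpaceSO3 : MeasurableSpace SO3 := borel SO3

instance instBorelSpaceSO3 : BorelSpace SO3 := ⟨rfl⟩

/-- The hat map, identifying a vector of `ℝ³` with a skew-symmetric matrix. -/
def hat (w : EuclideanSpace ℝ (Fin 3)) : Matrix (Fin 3) (Fin 3) ℝ :=
  !![0, -(w 2), w 1; w 2, 0, -(w 0); -(w 1), w 0, 0]

theorem hat_transpose (w : EuclideanSpace ℝ (Fin 3)) : (hat w).transpose = -hat w := by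
  ext i j
  fin_cases i <;> fin_cases j <;> simp [hat]

theorem hat_smul (c : ℝ) (w : EuclideanSpace ℝ (Fin 3)) : hat (c • w) = c • hat w := by
  ext i j
  fin_cases i <;> fin_cases j <;> simp [hat]

theorem exp_hat_transpose_mul (w : EuclideanSpace ℝ (Fin 3)) :
    (NormedSpace.exp (hat w)).transpose * NormedSpace.exp (hat w) = 1 := by
  rw [← Matrix.exp_transpose, hat_transpose, Matrix.exp_neg]
  exact Matrix.nonsing_inv_mul _ ((Matrix.isUnit_iff_isUnit_det _).1 (Matrix.isUnit_exp _))

theorem det_exp_hat (w : EuclideanSpace ℝ (Fin 3)) : (NormedSpace.exp (hat w)).det = 1 := by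
  have h1 : hat w = hat ((1 / 2 : ℝ) • w) + hat ((1 / 2 : ℝ) • w) := by
    rw [hat_smul, ← add_smul]
    norm_num
  have h2 := congrArg Matrix.det (exp_hat_transpose_mul ((1 / 2 : ℝ) • w))
  rw [Matrix.det_mul, Matrix.det_transpose, Matrix.det_one] at h2
  rw [h1, Matrix.exp_add_of_commute _ _ (Commute.refl _), Matrix.det_mul]
  exact h2

theorem exp_hat_mem (w : EuclideanSpace ℝ (Fin 3)) :
    NormedSpace.exp (hat w) ∈ Matrix.specialOrthogonalGroup (Fin 3) ℝ := by
  rw [Matrix.mem_specialOrthogonalGroup_iff]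
  refine ⟨?_, det_exp_hat w⟩
  rw [Matrix.mem_orthogonalGroup_iff']
  exact exp_hat_transpose_mul w

/-- The Riemannian exponential map `w ↦ exp_R (R ŵ) = R exp(ŵ)` of `SO(3)` at `R`. The tangent
space `T_R SO(3) = {R ŵ}`, with the metric `⟨R A, R B⟩ = (1/2) tr(Aᵀ B)`, is identified with
Euclidean `ℝ³` by the isometry `w ↦ R ŵ`. -/
noncomputable def riemannExp (R : SO3) (w : EuclideanSpace ℝ (Fin 3)) : SO3 :=
  R * ⟨NormedSpace.exp (hat w), exp_hat_mem w⟩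

/-- The intrinsic (Riemannian) gradient at `R` of a function on `SO(3)`, as a tangent vector
`R û` in the ambient space of matrices; it is computed in the normal coordinates at `R`. -/
noncomputable def riemannGrad (φ : SO3 → ℝ) (R : SO3) : Matrix (Fin 3) (Fin 3) ℝ :=
  (R : Matrix (Fin 3) (Fin 3) ℝ) * hat (gradient (fun w => φ (riemannExp R w)) 0)

/-- The geodesic distance on `SO(3)`: the rotation angle of `Rᵀ Q`. -/
noncomputable def geodDist (R Q : SO3) : ℝ :=
  Real.arccos
    ((((R : Matrix (Fin 3) (Fin 3) ℝ).transpose * (Q : Matrix (Fin 3) (Fin 3) ℝ)).trace - 1) / 2)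

/-- The open geodesic disk `D_{π/2 - ε}` centred at the identity. -/
def diskEps (ε : ℝ) : Set SO3 := {R | geodDist 1 R < Real.pi / 2 - ε}

/-! ### The interaction potential -/

/-- `K(R, Q) = g(d(R, Q)²)`, where `g : [0, ∞) → ℝ` is differentiable with locally Lipschitz
continuous derivative (the values of `g` on `(-∞, 0)` play no role). -/
structure IsInteractionPotential (K : SO3 → SO3 → ℝ) (g : ℝ → ℝ) : Prop where
  eq_comp : ∀ R Q : SO3, K R Q = g (geodDist R Q ^ 2)
  differentiable : DifferentiableOn ℝ g (Ici 0)
  deriv_locallyLipschitz : LocallyLipschitzOn (Ici 0) (derivWithin g (Ici 0))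

/-! ### Flow maps and weak solutions -/

/-- The time interval `[0, T)`, where `T` may be infinite. -/
def timeInterval (T : EReal) : Set ℝ := {t | 0 ≤ t ∧ (t : EReal) < T}

/-- `Ψ` is, on `S × [0, T)`, a flow map into `U` generated by the time-dependent vector field `X`
on `U × [0, T)` and the set `S ⊆ U`: `Ψ R 0 = R` and `d/dt Ψ R t = X(Ψ R t, t)` in the ambient space
of matrices, entry by entry, one-sided at `t = 0`. The values of `Ψ` outside `S × [0, T)` play no role. -/
def IsFlowMap {U : Set SO3} (X : U → ℝ → Matrix (Fin 3) (Fin 3) ℝ) (S : Set U) (T : EReal)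
    (Ψ : U → ℝ → U) : Prop :=
  ∀ R ∈ S, Ψ R 0 = R ∧ ∀ t ∈ timeInterval T, ∀ i j : Fin 3,
    HasDerivWithinAt (fun s => ((Ψ R s : SO3) : Matrix (Fin 3) (Fin 3) ℝ) i j)
      (X (Ψ R t) t i j) (timeInterval T) t

/-- The velocity field `v[ρ](R, t) = -(∇K * ρ_t)(R) = -∫ ∇K_Q(R) dρ_t(Q)`; the integral of the
matrix-valued function is taken entrywise. -/
noncomputable def velocity {U : Set SO3} (K : SO3 → SO3 → ℝ) (ρ : ℝ → ProbabilityMeasure U)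
    (R : U) (t : ℝ) : Matrix (Fin 3) (Fin 3) ℝ :=
  Matrix.of fun i j => -∫ Q : U, riemannGrad (fun P => K P Q) R i j ∂(ρ t : Measure U)

/-- Weak solutions on `[0, T)`, in the space of Borel probability measures on `U`, of
`∂_t ρ + ∇ · (ρ v) = 0`, `v = -∇K * ρ`: the field `v[ρ]` generates a unique flow map on
`supp(ρ_0) × [0, T)`, and `ρ_t` is the push-forward of `ρ_0` under it. -/
def IsWeakSolution {U : Set SO3} (K : SO3 → SO3 → ℝ) (T : EReal)
    (ρ : ℝ → ProbabilityMeasure U) : Prop :=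
  ∃ Ψ : U → ℝ → U,
    IsFlowMap (velocity K ρ) (ρ 0 : Measure U).support T Ψ ∧
    (∀ Φ : U → ℝ → U, IsFlowMap (velocity K ρ) (ρ 0 : Measure U).support T Φ →
      ∀ R ∈ (ρ 0 : Measure U).support, ∀ t ∈ timeInterval T, Φ R t = Ψ R t) ∧
    ∀ t ∈ timeInterval T,
      AEMeasurable (fun R => Ψ R t) (ρ 0 : Measure U) ∧
      (ρ t : Measure U) = (ρ 0 : Measure U).map (fun R => Ψ R t)

/-- The intrinsic `1`-Wasserstein distance between Borel probability measures on `U`. -/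
noncomputable def wasserstein {U : Set SO3} (μ ν : ProbabilityMeasure U) : ℝ :=
  sInf {c : ℝ | ∃ γ : ProbabilityMeasure (U × U),
    (γ : Measure (U × U)).map Prod.fst = (μ : Measure U) ∧
    (γ : Measure (U × U)).map Prod.snd = (ν : Measure U) ∧
    c = ∫ p : U × U, geodDist p.1 p.2 ∂(γ : Measure (U × U))}

/-! ### The explicit growth factor -/

/-- The function `f(θ) = θ / sin θ`, with `f(0) = 1`. -/
noncomputable def angleRatio (θ : ℝ) : ℝ := if θ = 0 then 1 else θ / Real.sin θ

/-- `C_f = sup f` over `[0, π - 2ε]`. -/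
noncomputable def supRatio (ε : ℝ) : ℝ := sSup (angleRatio '' Icc 0 (Real.pi - 2 * ε))

/-- `L_f = sup f'` over `[0, π - 2ε]`. -/
noncomputable def supDerivRatio (ε : ℝ) : ℝ :=
  sSup (deriv angleRatio '' Icc 0 (Real.pi - 2 * ε))

/-- `C_{g'}`: the supremum of `|g'|` over `[0, (π - 2ε)²]`. -/
noncomputable def supDerivG (g : ℝ → ℝ) (ε : ℝ) : ℝ :=
  sSup ((fun s => |derivWithin g (Ici 0) s|) '' Icc 0 ((Real.pi - 2 * ε) ^ 2))

/-- `L_{g'}`: the least Lipschitz constant of `g'` on `[0, (π - 2ε)²]`. -/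
noncomputable def lipDerivG (g : ℝ → ℝ) (ε : ℝ) : ℝ :=
  sInf {L : ℝ | 0 ≤ L ∧ ∀ s ∈ Icc 0 ((Real.pi - 2 * ε) ^ 2),
    ∀ t ∈ Icc 0 ((Real.pi - 2 * ε) ^ 2),
      |derivWithin g (Ici 0) s - derivWithin g (Ici 0) t| ≤ L * |s - t|}

/-- A Lipschitz constant of `R ↦ v[ρ](R, t)` on the disk, in the Frobenius norm. -/
noncomputable def lipSpace (g : ℝ → ℝ) (ε : ℝ) : ℝ :=
  4 * √2 * Real.pi ^ 2 * lipDerivG g ε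
    + 2 * √3 * supDerivG g ε * (supDerivRatio ε + √2 * supRatio ε)

/-- A Lipschitz constant of `ρ_t ↦ v[ρ](R, t)` with respect to the Wasserstein distance. -/
noncomputable def lipMeasure (g : ℝ → ℝ) (ε : ℝ) : ℝ :=
  1 / √2 * (4 * √2 * Real.pi ^ 2 * lipDerivG g ε
    + 2 * supDerivG g ε * (√3 * supDerivRatio ε + √2 * supRatio ε))

/-- The exponential rate. -/
noncomputable def growthRate (g : ℝ → ℝ) (ε : ℝ) : ℝ :=
  lipMeasure g ε
    + 2 * √6 * Real.pi * (Real.tan (Real.pi / 2 - ε) / (Real.pi / 2 - ε)) * supDerivG g ε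
    + lipSpace g ε / √2

/-- The factor `r(ε, t)`; it depends only on `g`, `ε` and `t`. -/
noncomputable def growthFactor (g : ℝ → ℝ) (ε t : ℝ) : ℝ := Real.exp (growthRate g ε * t)

/-! ### Rotation matrices -/

/-! The proof is a coupling argument. A coupling `γ` of the initial measures is carried by the two
flows to a coupling of `ρ t` and `σ t`. It therefore suffices to bound the growth of the `γ`-average
of `D p t`, the distance between the two trajectories issuing from `p.1` and `p.2`, and then to take
the infimum over `γ`.

In the left trivialization the velocities are vectors of `ℝ³`, and they can be subtracted at
different base points without parallel transport. The gradient of `d²` is carried by the axial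
vector of `Rᵀ Q`, which has norm `sin d`; rescaled by `d / sin d` it has norm `d`. Hence the
derivative of `D²` is at most `2 D` times the norm of the difference of the two velocities
(`hasDerivAt_geodDist_sq`). Each velocity is the `γ`-average of the field `kernelVec`
(`velocity_eq`), which is Lipschitz in both arguments with constant `Λ = kernelLip g ε`
(`norm_kernelVec_sub_le`). Formally `D' ≤ Λ (D + ∫ D dγ)`, and an averaged Grönwall inequality gives
`∫ D(t) dγ ≤ exp(2 Λ t) ∫ D(0) dγ` (`integral_le_exp_mul_integral`).

The Lipschitz estimate needs the triangle inequality in the disk, which comes from angles between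
unit quaternions, and distances bounded away from `π`, where `d / sin d` blows up. The constant `Λ`
is not the one in the statement; the comparison `2 Λ ≤ growthRate g ε` is elementary
(`two_mul_kernelLip_le_growthRate`). -/

theorem coe_inv_mul (R Q : SO3) :
    ((R⁻¹ * Q : SO3) : Matrix (Fin 3) (Fin 3) ℝ) =
      (R : Matrix (Fin 3) (Fin 3) ℝ).transpose * (Q : Matrix (Fin 3) (Fin 3) ℝ) := by
  have h : ((R⁻¹ : SO3) : Matrix (Fin 3) (Fin 3) ℝ) =
      (R : Matrix (Fin 3) (Fin 3) ℝ).transpose := by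
    change star (R : Matrix (Fin 3) (Fin 3) ℝ) = _
    rw [Matrix.star_eq_conjTranspose, Matrix.conjTranspose_eq_transpose_of_trivial]
  rw [← h]; rfl

theorem rotation_mul_transpose (R : SO3) :
    (R : Matrix (Fin 3) (Fin 3) ℝ) * (R : Matrix (Fin 3) (Fin 3) ℝ).transpose = 1 :=
  (Matrix.mem_orthogonalGroup_iff (Fin 3) ℝ).1 (Matrix.mem_specialOrthogonalGroup_iff.1 R.2).1

theorem rotation_transpose_mul (R : SO3) :
    (R : Matrix (Fin 3) (Fin 3) ℝ).transpose * (R : Matrix (Fin 3) (Fin 3) ℝ) = 1 :=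
  (Matrix.mem_orthogonalGroup_iff' (Fin 3) ℝ).1 (Matrix.mem_specialOrthogonalGroup_iff.1 R.2).1

theorem rotation_row (R : SO3) (i j : Fin 3) :
    R.1 i 0 * R.1 j 0 + R.1 i 1 * R.1 j 1 + R.1 i 2 * R.1 j 2 = if i = j then 1 else 0 := by
  have h := congrFun (congrFun (rotation_mul_transpose R) i) j
  rw [Matrix.one_apply, Matrix.mul_apply, Fin.sum_univ_three] at h
  simpa using h

theorem rotation_col (R : SO3) (i j : Fin 3) :
    R.1 0 i * R.1 0 j + R.1 1 i * R.1 1 j + R.1 2 i * R.1 2 j = if i = j then 1 else 0 := by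
  have h := congrFun (congrFun (rotation_transpose_mul R) i) j
  rw [Matrix.one_apply, Matrix.mul_apply, Fin.sum_univ_three] at h
  simpa using h

theorem rotation_adjugate (R : SO3) : R.1.adjugate = R.1.transpose := by
  have h : R.1.adjugate * R.1 = 1 := by
    rw [Matrix.adjugate_mul, (Matrix.mem_specialOrthogonalGroup_iff.1 R.2).2, one_smul]
  calc R.1.adjugate = R.1.adjugate * (R.1 * R.1.transpose) := by
        rw [rotation_mul_transpose, mul_one]
    _ = R.1.transpose := by rw [← mul_assoc, h, one_mul]

theorem rotation_cofactor (R : SO3) :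
    R.1 0 0 = R.1 1 1 * R.1 2 2 - R.1 1 2 * R.1 2 1 ∧
    R.1 1 1 = R.1 0 0 * R.1 2 2 - R.1 0 2 * R.1 2 0 ∧
    R.1 2 2 = R.1 0 0 * R.1 1 1 - R.1 0 1 * R.1 1 0 ∧
    R.1 0 1 = R.1 1 2 * R.1 2 0 - R.1 1 0 * R.1 2 2 ∧
    R.1 1 0 = R.1 0 2 * R.1 2 1 - R.1 0 1 * R.1 2 2 ∧
    R.1 0 2 = R.1 1 0 * R.1 2 1 - R.1 1 1 * R.1 2 0 ∧
    R.1 2 0 = R.1 0 1 * R.1 1 2 - R.1 0 2 * R.1 1 1 ∧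
    R.1 1 2 = R.1 0 1 * R.1 2 0 - R.1 0 0 * R.1 2 1 ∧
    R.1 2 1 = R.1 0 2 * R.1 1 0 - R.1 0 0 * R.1 1 2 := by
  have h := rotation_adjugate R
  rw [Matrix.adjugate_fin_three] at h
  have e : ∀ i j, R.1 i j = R.1.transpose j i := fun _ _ => rfl
  refine ⟨?_, ?_, ?_, ?_, ?_, ?_, ?_, ?_, ?_⟩ <;> rw [e, ← h] <;> simp <;> ring

/-- The axial vector of the skew-symmetric part of a matrix. -/
noncomputable def axial (M : Matrix (Fin 3) (Fin 3) ℝ) : EuclideanSpace ℝ (Fin 3) :=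
  !₂[(M 2 1 - M 1 2) / 2, (M 0 2 - M 2 0) / 2, (M 1 0 - M 0 1) / 2]

theorem axial_add (A B : Matrix (Fin 3) (Fin 3) ℝ) : axial (A + B) = axial A + axial B := by
  ext i
  fin_cases i <;> simp [axial] <;> ring

theorem axial_sub (A B : Matrix (Fin 3) (Fin 3) ℝ) : axial (A - B) = axial A - axial B := by
  ext i
  fin_cases i <;> simp [axial] <;> ring

theorem axial_transpose (A : Matrix (Fin 3) (Fin 3) ℝ) : axial A.transpose = -axial A := by
  ext i
  fin_cases i <;> simp [axial] <;> ring

theorem trace_mul_hat (M : Matrix (Fin 3) (Fin 3) ℝ) (w : EuclideanSpace ℝ (Fin 3)) :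
    (M * hat w).trace = -2 * inner ℝ (axial M) w := by
  simp [Matrix.trace, Matrix.mul_apply, Fin.sum_univ_three, hat, axial, PiLp.inner_apply]
  ring

theorem norm_axial_sq_le (M : Matrix (Fin 3) (Fin 3) ℝ) :
    ‖axial M‖ ^ 2 ≤ (M.transpose * M).trace / 2 := by
  simp only [EuclideanSpace.norm_sq_eq, Fin.sum_univ_three, axial, Matrix.trace, Matrix.diag,
    Matrix.mul_apply, Matrix.transpose_apply, Real.norm_eq_abs, sq_abs]
  simp
  nlinarith [sq_nonneg (M 0 0), sq_nonneg (M 1 1), sq_nonneg (M 2 2), sq_nonneg (M 2 1 + M 1 2),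
    sq_nonneg (M 0 2 + M 2 0), sq_nonneg (M 1 0 + M 0 1)]

/-- The cosine of the rotation angle of a matrix. -/
noncomputable def rotCos (M : Matrix (Fin 3) (Fin 3) ℝ) : ℝ := (M.trace - 1) / 2

/-- Unit rows give the sum of the squared entries, and the diagonal cofactor identities eliminate
the products `R i j * R j i`. -/
theorem norm_axial_sq (R : SO3) : ‖axial R.1‖ ^ 2 = 1 - rotCos R.1 ^ 2 := by
  obtain ⟨h0, h1, h2, -⟩ := rotation_cofactor R
  have r0 := rotation_row R 0 0
  have r1 := rotation_row R 1 1
  have r2 := rotation_row R 2 2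
  simp only [if_true] at r0 r1 r2
  simp only [EuclideanSpace.norm_sq_eq, Fin.sum_univ_three, axial, rotCos, Matrix.trace,
    Matrix.diag, Real.norm_eq_abs, sq_abs]
  simp
  linear_combination (1 / 4) * (r0 + r1 + r2) - (1 / 2) * (h0 + h1 + h2)

theorem abs_rotCos_le_one (R : SO3) : |rotCos R.1| ≤ 1 := by
  rw [← sq_le_one_iff_abs_le_one]
  linarith [norm_axial_sq R, sq_nonneg ‖axial R.1‖]

theorem geodDist_eq (R Q : SO3) : geodDist R Q = Real.arccos (rotCos (R⁻¹ * Q : SO3).1) := by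
  rw [geodDist, rotCos, coe_inv_mul]

theorem cos_geodDist (R Q : SO3) : Real.cos (geodDist R Q) = rotCos (R⁻¹ * Q : SO3).1 := by
  have h := abs_le.1 (abs_rotCos_le_one (R⁻¹ * Q))
  rw [geodDist_eq, Real.cos_arccos h.1 h.2]

theorem geodDist_nonneg (R Q : SO3) : 0 ≤ geodDist R Q := Real.arccos_nonneg _

theorem geodDist_le_pi (R Q : SO3) : geodDist R Q ≤ Real.pi := Real.arccos_le_pi _

theorem geodDist_comm (R Q : SO3) : geodDist R Q = geodDist Q R := by
  rw [geodDist, geodDist, ← Matrix.trace_transpose, Matrix.transpose_mul,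
    Matrix.transpose_transpose]

theorem geodDist_self (R : SO3) : geodDist R R = 0 := by
  rw [geodDist, rotation_transpose_mul]
  norm_num [Matrix.trace_one]

theorem norm_axial_inv_mul (R Q : SO3) :
    ‖axial (R⁻¹ * Q : SO3).1‖ = Real.sin (geodDist R Q) := by
  have h0 : 0 ≤ Real.sin (geodDist R Q) :=
    Real.sin_nonneg_of_nonneg_of_le_pi (geodDist_nonneg R Q) (geodDist_le_pi R Q)
  rw [← sq_eq_sq₀ (norm_nonneg _) h0, norm_axial_sq, Real.sin_sq, cos_geodDist]

theorem continuous_geodDist {X : Type*} [TopologicalSpace X] {f h : X → SO3}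
    (hf : Continuous f) (hh : Continuous h) : Continuous fun x => geodDist (f x) (h x) := by
  unfold geodDist
  refine Real.continuous_arccos.comp ?_
  have h1 : Continuous fun x => (f x : Matrix (Fin 3) (Fin 3) ℝ) :=
    continuous_subtype_val.comp hf
  have h2 : Continuous fun x => (h x : Matrix (Fin 3) (Fin 3) ℝ) :=
    continuous_subtype_val.comp hh
  exact (((h1.matrix_transpose.matrix_mul h2).matrix_trace).sub continuous_const).div_const 2

/-! ### Unit quaternions and the triangle inequality -/

/-- The matrix of the conjugation by the quaternion `q 0 + q 1 i + q 2 j + q 3 k`. -/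
def quatMatrix (q : EuclideanSpace ℝ (Fin 4)) : Matrix (Fin 3) (Fin 3) ℝ :=
  !![q 0 ^ 2 + q 1 ^ 2 - q 2 ^ 2 - q 3 ^ 2, 2 * (q 1 * q 2 - q 0 * q 3),
      2 * (q 1 * q 3 + q 0 * q 2);
    2 * (q 1 * q 2 + q 0 * q 3), q 0 ^ 2 - q 1 ^ 2 + q 2 ^ 2 - q 3 ^ 2,
      2 * (q 2 * q 3 - q 0 * q 1);
    2 * (q 1 * q 3 - q 0 * q 2), 2 * (q 2 * q 3 + q 0 * q 1),
      q 0 ^ 2 - q 1 ^ 2 - q 2 ^ 2 + q 3 ^ 2]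

theorem trace_quatMatrix (p q : EuclideanSpace ℝ (Fin 4)) :
    ((quatMatrix p).transpose * quatMatrix q).trace =
      4 * (inner ℝ p q : ℝ) ^ 2 - ‖p‖ ^ 2 * ‖q‖ ^ 2 := by
  simp only [EuclideanSpace.norm_sq_eq, Fin.sum_univ_four, Real.norm_eq_abs, sq_abs,
    PiLp.inner_apply, Matrix.trace, Matrix.diag, Matrix.mul_apply, Matrix.transpose_apply,
    Fin.sum_univ_three, quatMatrix]
  simp
  ring

/-- The real part is forced to be `a = √(1 + tr R) / 2`, and the imaginary part to be the skew part
of `R` divided by `4 a`. Orthogonality and the cofactor identities evaluate all products of the skew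
entries as multiples of `1 + tr R = 4 a²`, so the denominators cancel. -/
theorem exists_quatMatrix_eq (R : SO3) (h : -1 < R.1.trace) :
    ∃ q : EuclideanSpace ℝ (Fin 4), ‖q‖ = 1 ∧ 0 ≤ q 0 ∧ 4 * q 0 ^ 2 = 1 + R.1.trace ∧
      R.1 = quatMatrix q := by
  obtain ⟨c00, c11, c22, c01, c10, c02, c20, c12, c21⟩ := rotation_cofactor R
  have r := rotation_row R
  have c := rotation_col R
  have r00 := r 0 0
  have r11 := r 1 1
  have r22 := r 2 2
  have s00 := c 0 0
  have s11 := c 1 1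
  have s22 := c 2 2
  have r01 := r 0 1
  have r02 := r 0 2
  have r12 := r 1 2
  have s01 := c 0 1
  have s02 := c 0 2
  have s12 := c 1 2
  have ht : R.1.trace = R.1 0 0 + R.1 1 1 + R.1 2 2 := Matrix.trace_fin_three _
  rw [ht] at h ⊢
  simp at r00 r11 r22 r01 r02 r12 s00 s11 s22 s01 s02 s12
  have hb : (R.1 2 1 - R.1 1 2) ^ 2 = (1 + (R.1 0 0 + R.1 1 1 + R.1 2 2)) *
      (1 + R.1 0 0 - R.1 1 1 - R.1 2 2) := by
    linear_combination r11 + r22 - s00 - 2 * c00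
  have hc : (R.1 0 2 - R.1 2 0) ^ 2 = (1 + (R.1 0 0 + R.1 1 1 + R.1 2 2)) *
      (1 + R.1 1 1 - R.1 0 0 - R.1 2 2) := by
    linear_combination r00 + r22 - s11 - 2 * c11
  have hd : (R.1 1 0 - R.1 0 1) ^ 2 = (1 + (R.1 0 0 + R.1 1 1 + R.1 2 2)) *
      (1 + R.1 2 2 - R.1 0 0 - R.1 1 1) := by
    linear_combination r00 + r11 - s22 - 2 * c22
  have hbc : (R.1 2 1 - R.1 1 2) * (R.1 0 2 - R.1 2 0) =
      (1 + (R.1 0 0 + R.1 1 1 + R.1 2 2)) * (R.1 0 1 + R.1 1 0) := by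
    linear_combination -c01 - c10 - s01 - r01
  have hbd : (R.1 2 1 - R.1 1 2) * (R.1 1 0 - R.1 0 1) =
      (1 + (R.1 0 0 + R.1 1 1 + R.1 2 2)) * (R.1 0 2 + R.1 2 0) := by
    linear_combination -c02 - c20 - s02 - r02
  have hcd : (R.1 0 2 - R.1 2 0) * (R.1 1 0 - R.1 0 1) =
      (1 + (R.1 0 0 + R.1 1 1 + R.1 2 2)) * (R.1 1 2 + R.1 2 1) := by
    linear_combination -c12 - c21 - s12 - r12
  have hτ : 0 < 1 + (R.1 0 0 + R.1 1 1 + R.1 2 2) := by linarith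
  obtain ⟨a, ha0, ha⟩ : ∃ a : ℝ, 0 < a ∧ 4 * a ^ 2 = 1 + (R.1 0 0 + R.1 1 1 + R.1 2 2) :=
    ⟨√(1 + (R.1 0 0 + R.1 1 1 + R.1 2 2)) / 2, by positivity, by
      rw [div_pow, Real.sq_sqrt hτ.le]; ring⟩
  rw [← ha] at hb hc hd hbc hbd hcd
  have quot : ∀ x y z : ℝ, x * y = 4 * a ^ 2 * z → x / (4 * a) * (y / (4 * a)) = z / 4 := by
    intro x y z hxyz
    rw [div_mul_div_comm, hxyz]
    field_simp
  have eb := quot _ _ _ ((sq _).symm.trans hb)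
  have ec := quot _ _ _ ((sq _).symm.trans hc)
  have ed := quot _ _ _ ((sq _).symm.trans hd)
  have ebc := quot _ _ _ hbc
  have ebd := quot _ _ _ hbd
  have ecd := quot _ _ _ hcd
  have lin : ∀ x : ℝ, a * (x / (4 * a)) = x / 4 := fun x => by field_simp
  have eab := lin (R.1 2 1 - R.1 1 2)
  have eac := lin (R.1 0 2 - R.1 2 0)
  have ead := lin (R.1 1 0 - R.1 0 1)
  refine ⟨!₂[a, (R.1 2 1 - R.1 1 2) / (4 * a), (R.1 0 2 - R.1 2 0) / (4 * a),
    (R.1 1 0 - R.1 0 1) / (4 * a)], ?_, ha0.le, ha, ?_⟩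
  · rw [← sq_eq_sq₀ (norm_nonneg _) zero_le_one, EuclideanSpace.norm_sq_eq, Fin.sum_univ_four]
    simp only [Real.norm_eq_abs, sq_abs]
    simp only [Matrix.cons_val]
    linear_combination eb + ec + ed + (1 / 4) * ha
  · ext i j
    fin_cases i <;> fin_cases j <;>
      simp only [quatMatrix, Matrix.cons_val, Matrix.of_apply, Fin.zero_eta,
        Fin.mk_one, Fin.reduceFinMk]
    · linear_combination -eb + ec + ed - (1 / 4) * ha
    · linear_combination -2 * ebc + 2 * ead
    · linear_combination -2 * ebd - 2 * eac
    · linear_combination -2 * ebc - 2 * ead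
    · linear_combination eb - ec + ed - (1 / 4) * ha
    · linear_combination -2 * ecd + 2 * eab
    · linear_combination -2 * ebd + 2 * eac
    · linear_combination -2 * ecd - 2 * eab
    · linear_combination eb + ec - ed - (1 / 4) * ha

theorem trace_inv_mul_eq (R Q : SO3) :
    (R⁻¹ * Q : SO3).1.trace = 1 + 2 * Real.cos (geodDist R Q) := by
  rw [cos_geodDist, rotCos]
  ring

theorem trace_eq_of_geodDist_one (R : SO3) : R.1.trace = 1 + 2 * Real.cos (geodDist 1 R) := by
  rw [← trace_inv_mul_eq, inv_one, one_mul]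

/-- In the disk of radius `π / 2` about the identity, the geodesic distance is twice the angle
between unit quaternions with nonnegative real part. -/
theorem exists_quaternion_lift : ∃ q : SO3 → EuclideanSpace ℝ (Fin 4),
    ∀ R Q : SO3, geodDist 1 R < Real.pi / 2 → geodDist 1 Q < Real.pi / 2 →
      geodDist R Q = 2 * InnerProductGeometry.angle (q R) (q Q) := by
  have lift : ∀ R : SO3, ∃ q : EuclideanSpace ℝ (Fin 4), geodDist 1 R < Real.pi / 2 →
      ‖q‖ = 1 ∧ 1 < 2 * q 0 ^ 2 ∧ 0 ≤ q 0 ∧ R.1 = quatMatrix q := by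
    intro R
    by_cases h : geodDist 1 R < Real.pi / 2
    · have hc : 0 < Real.cos (geodDist 1 R) :=
        Real.cos_pos_of_mem_Ioo ⟨by linarith [geodDist_nonneg 1 R, Real.pi_pos], h⟩
      have ht := trace_eq_of_geodDist_one R
      obtain ⟨q, hq1, hq0, hq, hR⟩ := exists_quatMatrix_eq R (by linarith)
      exact ⟨q, fun _ => ⟨hq1, by linarith, hq0, hR⟩⟩
    · exact ⟨0, fun h' => absurd h' h⟩
  choose q hq using lift
  refine ⟨q, fun R Q hR hQ => ?_⟩
  obtain ⟨nR, aR, pR, eR⟩ := hq R hR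
  obtain ⟨nQ, aQ, pQ, eQ⟩ := hq Q hQ
  have hnR : q R 0 ^ 2 + q R 1 ^ 2 + q R 2 ^ 2 + q R 3 ^ 2 = 1 := by
    have := EuclideanSpace.norm_sq_eq (q R)
    rw [nR] at this
    simpa [Fin.sum_univ_four] using this.symm
  have hnQ : q Q 0 ^ 2 + q Q 1 ^ 2 + q Q 2 ^ 2 + q Q 3 ^ 2 = 1 := by
    have := EuclideanSpace.norm_sq_eq (q Q)
    rw [nQ] at this
    simpa [Fin.sum_univ_four] using this.symm
  have hin : (inner ℝ (q R) (q Q) : ℝ) =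
      q R 0 * q Q 0 + (q R 1 * q Q 1 + q R 2 * q Q 2 + q R 3 * q Q 3) := by
    simp [PiLp.inner_apply, Fin.sum_univ_four]
    ring
  -- Both real parts are at least `1 / √2`, so both imaginary parts have norm at most `1 / √2`. The
  -- inner product is then nonnegative and the angle at most `π / 2`, which selects the correct
  -- branch of `cos d = cos (2 * angle)`.
  have h00 : 1 / 2 ≤ q R 0 * q Q 0 := by
    refine (sq_le_sq₀ (by norm_num) (mul_nonneg pR pQ)).1 ?_
    rw [mul_pow]
    nlinarith
  have hpos : 0 ≤ (inner ℝ (q R) (q Q) : ℝ) := by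
    rw [hin]
    nlinarith [sq_nonneg (q R 1 + q Q 1), sq_nonneg (q R 2 + q Q 2), sq_nonneg (q R 3 + q Q 3)]
  have hcos : Real.cos (geodDist R Q) = 2 * (inner ℝ (q R) (q Q) : ℝ) ^ 2 - 1 := by
    rw [cos_geodDist, rotCos, coe_inv_mul, eR, eQ, trace_quatMatrix, nR, nQ]
    ring
  have hang : Real.cos (InnerProductGeometry.angle (q R) (q Q)) = inner ℝ (q R) (q Q) := by
    rw [InnerProductGeometry.cos_angle, nR, nQ]
    simp
  have hle : InnerProductGeometry.angle (q R) (q Q) ≤ Real.pi / 2 := by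
    rw [InnerProductGeometry.angle]
    exact Real.arccos_le_pi_div_two.2 (by rw [nR, nQ]; simpa using hpos)
  refine Real.injOn_cos ⟨geodDist_nonneg R Q, geodDist_le_pi R Q⟩
    ⟨mul_nonneg zero_le_two (InnerProductGeometry.angle_nonneg _ _), by linarith⟩ ?_
  rw [hcos, Real.cos_two_mul, hang]

theorem geodDist_triangle {x y z : SO3} (hx : geodDist 1 x < Real.pi / 2)
    (hy : geodDist 1 y < Real.pi / 2) (hz : geodDist 1 z < Real.pi / 2) :
    geodDist x z ≤ geodDist x y + geodDist y z := by
  obtain ⟨q, hq⟩ := exists_quaternion_lift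
  rw [hq x z hx hz, hq x y hx hy, hq y z hy hz]
  linarith [InnerProductGeometry.angle_le_angle_add_angle (q x) (q y) (q z)]

theorem lt_half_pi_of_mem_diskEps {ε : ℝ} (hε : 0 < ε) {x : SO3} (hx : x ∈ diskEps ε) :
    geodDist 1 x < Real.pi / 2 := by
  have : geodDist 1 x < Real.pi / 2 - ε := hx
  linarith

theorem geodDist_lt_of_mem_diskEps {ε : ℝ} (hε : 0 < ε) {x y : SO3} (hx : x ∈ diskEps ε)
    (hy : y ∈ diskEps ε) : geodDist x y < Real.pi - 2 * ε := by
  have h1 : geodDist 1 x < Real.pi / 2 - ε := hx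
  have h2 : geodDist 1 y < Real.pi / 2 - ε := hy
  have h3 : geodDist 1 (1 : SO3) < Real.pi / 2 := by
    rw [geodDist_self]
    positivity
  have h := geodDist_triangle (lt_half_pi_of_mem_diskEps hε hx) h3
    (lt_half_pi_of_mem_diskEps hε hy)
  rw [geodDist_comm x 1] at h
  linarith

theorem abs_geodDist_sub_le {ε : ℝ} (hε : 0 < ε) {x x' y y' : SO3} (hx : x ∈ diskEps ε)
    (hx' : x' ∈ diskEps ε) (hy : y ∈ diskEps ε) (hy' : y' ∈ diskEps ε) :
    |geodDist x x' - geodDist y y'| ≤ geodDist x y + geodDist x' y' := by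
  have kx := lt_half_pi_of_mem_diskEps hε hx
  have kx' := lt_half_pi_of_mem_diskEps hε hx'
  have ky := lt_half_pi_of_mem_diskEps hε hy
  have ky' := lt_half_pi_of_mem_diskEps hε hy'
  have h1 := geodDist_triangle kx ky kx'
  have h2 := geodDist_triangle ky ky' kx'
  have h3 := geodDist_triangle ky kx ky'
  have h4 := geodDist_triangle kx kx' ky'
  rw [geodDist_comm y' x'] at h2
  rw [geodDist_comm y x] at h3
  rw [abs_le]
  constructor <;> linarith

theorem trace_sub_transpose_mul_sub (x y : SO3) :
    ((x.1 - y.1).transpose * (x.1 - y.1)).trace / 2 = 2 * (1 - Real.cos (geodDist x y)) := by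
  have h := trace_inv_mul_eq x y
  have h' := trace_inv_mul_eq y x
  rw [coe_inv_mul] at h h'
  rw [geodDist_comm y x] at h'
  rw [Matrix.transpose_sub, sub_mul, mul_sub, mul_sub, rotation_transpose_mul,
    rotation_transpose_mul, Matrix.trace_sub, Matrix.trace_sub, Matrix.trace_sub,
    Matrix.trace_one, h, h']
  simp
  ring

/-- The chord is shorter than the arc: half the squared Frobenius norm of `x - y` is `2 (1 - cos d)
≤ d²`, and the rotation `zᵀ` preserves that norm. -/
theorem norm_axial_transpose_mul_sub_le (z x y : SO3) :
    ‖axial (z.1.transpose * (x.1 - y.1))‖ ≤ geodDist x y := by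
  rw [← sq_le_sq₀ (norm_nonneg _) (geodDist_nonneg x y)]
  refine (norm_axial_sq_le _).trans ?_
  rw [Matrix.transpose_mul, Matrix.transpose_transpose, mul_assoc, ← mul_assoc z.1,
    rotation_mul_transpose, one_mul, trace_sub_transpose_mul_sub]
  linarith [Real.one_sub_sq_div_two_le_cos (x := geodDist x y)]

theorem norm_axial_sub_le (x x' y y' : SO3) :
    ‖axial (x⁻¹ * x' : SO3).1 - axial (y⁻¹ * y' : SO3).1‖ ≤ geodDist x y + geodDist x' y' := by
  have h : axial (x⁻¹ * x' : SO3).1 - axial (y⁻¹ * y' : SO3).1 =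
      axial (x.1.transpose * (x'.1 - y'.1)) - axial (y'.1.transpose * (x.1 - y.1)) := by
    have e : y'.1.transpose * (x.1 - y.1) = ((x.1 - y.1).transpose * y'.1).transpose := by
      rw [Matrix.transpose_mul, Matrix.transpose_transpose]
    rw [coe_inv_mul, coe_inv_mul, e, axial_transpose, sub_neg_eq_add, ← axial_add, ← axial_sub]
    congr 1
    rw [Matrix.transpose_sub, sub_mul, mul_sub]
    abel
  rw [h]
  have h1 := norm_axial_transpose_mul_sub_le x x' y'
  have h2 := norm_axial_transpose_mul_sub_le y' x y
  linarith [norm_sub_le (axial (x.1.transpose * (x'.1 - y'.1)))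
    (axial (y'.1.transpose * (x.1 - y.1)))]

/-! ### The ratio `θ / sin θ` and the growth rate -/

theorem angleRatio_eq_inv_sinc (θ : ℝ) : angleRatio θ = (Real.sinc θ)⁻¹ := by
  rw [angleRatio, Real.sinc_apply]
  split_ifs <;> simp

theorem sinc_pos {θ : ℝ} (h0 : 0 ≤ θ) (h1 : θ < Real.pi) : 0 < Real.sinc θ := by
  rcases h0.eq_or_lt with rfl | h
  · simp
  · rw [Real.sinc_of_ne_zero h.ne']
    exact div_pos (Real.sin_pos_of_pos_of_lt_pi h h1) h

theorem angleRatio_pos {θ : ℝ} (h0 : 0 ≤ θ) (h1 : θ < Real.pi) : 0 < angleRatio θ := by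
  rw [angleRatio_eq_inv_sinc]
  exact inv_pos.2 (sinc_pos h0 h1)

theorem angleRatio_mul_sin {θ : ℝ} (h0 : 0 ≤ θ) (h1 : θ < Real.pi) :
    angleRatio θ * Real.sin θ = θ := by
  rcases h0.eq_or_lt with rfl | h
  · simp
  · rw [angleRatio, if_neg h.ne', div_mul_cancel₀ _ (Real.sin_pos_of_pos_of_lt_pi h h1).ne']

theorem sinc_antitoneOn : AntitoneOn Real.sinc (Icc 0 Real.pi) := by
  intro x hx y hy hxy
  rcases hx.1.eq_or_lt with rfl | h
  · simpa using Real.sinc_le_one y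
  · have hy0 : 0 < y := h.trans_le hxy
    rw [Real.sinc_of_ne_zero h.ne', Real.sinc_of_ne_zero hy0.ne', div_le_div_iff₀ hy0 h]
    have h1 : 0 ≤ 1 - x / y := sub_nonneg.2 ((div_le_one hy0).2 hxy)
    have h2 : 0 ≤ x / y := by positivity
    have hc := strictConcaveOn_sin_Icc.concaveOn.2 (left_mem_Icc.2 Real.pi_pos.le) hy h1 h2
      (sub_add_cancel _ _)
    simp only [smul_eq_mul, mul_zero, Real.sin_zero, zero_add, div_mul_cancel₀ _ hy0.ne'] at hc
    rw [div_mul_eq_mul_div, div_le_iff₀ hy0] at hc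
    linarith

theorem angleRatio_le {x y : ℝ} (hx : 0 ≤ x) (hxy : x ≤ y) (hy : y < Real.pi) :
    angleRatio x ≤ angleRatio y := by
  rw [angleRatio_eq_inv_sinc, angleRatio_eq_inv_sinc]
  exact inv_anti₀ (sinc_pos (hx.trans hxy) hy)
    (sinc_antitoneOn ⟨hx, hxy.trans hy.le⟩ ⟨hx.trans hxy, hy.le⟩ hxy)

theorem supRatio_eq {ε : ℝ} (hε : 0 < ε) (hε' : ε < Real.pi / 2) :
    supRatio ε = angleRatio (Real.pi - 2 * ε) := by
  refine IsGreatest.csSup_eq ⟨⟨_, ⟨by linarith, le_rfl⟩, rfl⟩, ?_⟩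
  rintro _ ⟨θ, hθ, rfl⟩
  exact angleRatio_le hθ.1 hθ.2 (by linarith)

theorem angleRatio_le_supRatio {ε θ : ℝ} (hε : 0 < ε) (hε' : ε < Real.pi / 2) (h0 : 0 ≤ θ)
    (h1 : θ ≤ Real.pi - 2 * ε) : angleRatio θ ≤ supRatio ε := by
  rw [supRatio_eq hε hε']
  exact angleRatio_le h0 h1 (by linarith)

theorem supRatio_pos {ε : ℝ} (hε : 0 < ε) (hε' : ε < Real.pi / 2) : 0 < supRatio ε := by
  rw [supRatio_eq hε hε']
  exact angleRatio_pos (by linarith) (by linarith)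

/-- The ratio is even, so its derivative at `0` vanishes and `0` belongs to the set. Boundedness is
not needed, since the real `sSup` of an unbounded set is `0`. -/
theorem supDerivRatio_nonneg {ε : ℝ} (hε' : ε < Real.pi / 2) : 0 ≤ supDerivRatio ε := by
  refine Real.sSup_nonneg' ⟨_, ⟨0, ⟨le_rfl, by linarith⟩, rfl⟩, ?_⟩
  have h : deriv (fun θ => angleRatio (-θ)) 0 = -deriv angleRatio (-0) := deriv_comp_neg _ _
  have e : (fun θ => angleRatio (-θ)) = angleRatio := by
    funext θ
    rw [angleRatio_eq_inv_sinc, angleRatio_eq_inv_sinc, Real.sinc_neg]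
  rw [e, neg_zero] at h
  linarith

theorem one_le_tan_div {α : ℝ} (h0 : 0 < α) (h1 : α < Real.pi / 2) : 1 ≤ Real.tan α / α :=
  (one_le_div h0).2 (Real.le_tan h0.le h1)

/-- With `α = π / 2 - ε` the claim reduces to `(2 / 5) α² ≤ sin² α`. This follows from Jordan's
inequality `sin α ≥ 2 α / π` and `π² < 10`. -/
theorem supRatio_le_tan_div {ε : ℝ} (hε : 0 < ε) (hε' : ε < Real.pi / 2) :
    2 / 5 * supRatio ε ≤ Real.tan (Real.pi / 2 - ε) / (Real.pi / 2 - ε) := by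
  obtain ⟨α, hα⟩ : ∃ α, α = Real.pi / 2 - ε := ⟨_, rfl⟩
  have h0 : 0 < α := by linarith
  have h1 : α < Real.pi / 2 := by linarith
  rw [supRatio_eq hε hε', ← hα, show Real.pi - 2 * ε = 2 * α by linarith, angleRatio,
    if_neg (by positivity), Real.sin_two_mul, Real.tan_eq_sin_div_cos]
  have hs : 2 / Real.pi * α ≤ Real.sin α := Real.mul_le_sin h0.le h1.le
  have hs0 : 0 < Real.sin α := Real.sin_pos_of_pos_of_lt_pi h0 (by linarith [Real.pi_pos])
  have hc0 : 0 < Real.cos α := Real.cos_pos_of_mem_Ioo ⟨by linarith, h1⟩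
  have hp : 2 / 5 * α ^ 2 ≤ Real.sin α ^ 2 := by
    have h2 : (2 / Real.pi * α) ^ 2 ≤ Real.sin α ^ 2 :=
      pow_le_pow_left₀ (by positivity) hs 2
    have h3 : 2 / 5 ≤ (2 / Real.pi) ^ 2 := by
      rw [div_pow, le_div_iff₀ (by positivity)]
      nlinarith [Real.pi_lt_d2, Real.pi_pos]
    rw [mul_pow] at h2
    nlinarith [sq_nonneg α]
  rw [div_div, ← mul_div_assoc, div_le_div_iff₀ (by positivity) (by positivity)]
  nlinarith [mul_pos hs0 hc0, mul_le_mul_of_nonneg_left hp hc0.le]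

theorem lipDerivG_nonneg (g : ℝ → ℝ) (ε : ℝ) : 0 ≤ lipDerivG g ε :=
  Real.sInf_nonneg fun _ h => h.1

theorem supDerivG_nonneg (g : ℝ → ℝ) (ε : ℝ) : 0 ≤ supDerivG g ε := by
  refine Real.sSup_nonneg ?_
  rintro _ ⟨s, -, rfl⟩
  exact abs_nonneg _

theorem abs_derivWithin_le_supDerivG {g : ℝ → ℝ}
    (hg : LocallyLipschitzOn (Ici 0) (derivWithin g (Ici 0))) {ε s : ℝ}
    (hs : s ∈ Icc 0 ((Real.pi - 2 * ε) ^ 2)) : |derivWithin g (Ici 0) s| ≤ supDerivG g ε :=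
  le_csSup (isCompact_Icc.bddAbove_image
    (hg.continuousOn.mono Icc_subset_Ici_self).abs) ⟨s, hs, rfl⟩

/-- Compactness of the interval supplies a global Lipschitz constant, so the infimum is over a
nonempty set and is itself a Lipschitz constant. -/
theorem abs_derivWithin_sub_le {g : ℝ → ℝ}
    (hg : LocallyLipschitzOn (Ici 0) (derivWithin g (Ici 0))) {ε s t : ℝ}
    (hs : s ∈ Icc 0 ((Real.pi - 2 * ε) ^ 2)) (ht : t ∈ Icc 0 ((Real.pi - 2 * ε) ^ 2)) :
    |derivWithin g (Ici 0) s - derivWithin g (Ici 0) t| ≤ lipDerivG g ε * |s - t| := by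
  obtain ⟨C, hC⟩ := (hg.mono (Icc_subset_Ici_self :
    Icc 0 ((Real.pi - 2 * ε) ^ 2) ⊆ Ici 0)).exists_lipschitzOnWith_of_compact isCompact_Icc
  rcases (abs_nonneg (s - t)).eq_or_lt with h | h
  · have e : s = t := sub_eq_zero.1 (abs_eq_zero.1 h.symm)
    simp [e]
  · rw [← div_le_iff₀ h]
    refine le_csInf ⟨C, C.2, fun a ha b hb => ?_⟩ fun L hL =>
      (div_le_iff₀ h).2 (hL.2 s hs t ht)
    simpa [Real.dist_eq] using hC.dist_le_mul a ha b hb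

/-- A Lipschitz constant of the interaction field in each of its arguments. -/
noncomputable def kernelLip (g : ℝ → ℝ) (ε : ℝ) : ℝ :=
  4 * Real.pi ^ 2 * lipDerivG g ε + 2 * supDerivG g ε * (1 + 2 * supRatio ε)

theorem kernelLip_nonneg (g : ℝ → ℝ) {ε : ℝ} (hε : 0 < ε) (hε' : ε < Real.pi / 2) :
    0 ≤ kernelLip g ε := by
  have := lipDerivG_nonneg g ε
  have := supDerivG_nonneg g ε
  have := supRatio_pos hε hε'
  unfold kernelLip
  positivity

/-- The `lipDerivG` terms agree exactly. What remains is `4 + 8 F ≤ 2 F + 2 √3 F + 2 √6 π τ` with `F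
= supRatio ε` and `τ = tan α / α`, where `α = π / 2 - ε`. It follows from `τ ≥ 1` and `τ ≥ (2 / 5)
F`; the `supDerivRatio` term is nonnegative and is discarded. -/
theorem two_mul_kernelLip_le_growthRate (g : ℝ → ℝ) {ε : ℝ} (hε : 0 < ε)
    (hε' : ε < Real.pi / 2) : 2 * kernelLip g ε ≤ growthRate g ε := by
  have hC := supDerivG_nonneg g ε
  have hLf := supDerivRatio_nonneg hε'
  have hCf := supRatio_pos hε hε'
  have h2 : √2 ≠ 0 := by positivity
  have h3 : (1.7 : ℝ) ≤ √3 := Real.le_sqrt_of_sq_le (by norm_num)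
  have h6 : (2.4 : ℝ) ≤ √6 := Real.le_sqrt_of_sq_le (by norm_num)
  have t1 := one_le_tan_div (α := Real.pi / 2 - ε) (by linarith) (by linarith)
  have t2 := supRatio_le_tan_div hε hε'
  have h6p : (2.4 : ℝ) * 3.1 ≤ √6 * Real.pi :=
    mul_le_mul h6 (by linarith [Real.pi_gt_d2]) (by norm_num) (by positivity)
  unfold growthRate lipMeasure lipSpace kernelLip
  generalize Real.tan (Real.pi / 2 - ε) / (Real.pi / 2 - ε) = τ at *
  generalize supDerivG g ε = C at *
  generalize lipDerivG g ε = L at *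
  generalize supRatio ε = F at *
  generalize supDerivRatio ε = D at *
  have e : 1 / √2 * (4 * √2 * Real.pi ^ 2 * L + 2 * C * (√3 * D + √2 * F)) +
      2 * √6 * Real.pi * τ * C + (4 * √2 * Real.pi ^ 2 * L + 2 * √3 * C * (D + √2 * F)) / √2 =
      8 * Real.pi ^ 2 * L + C * (4 * (√3 * D / √2) + 2 * F + 2 * (√3 * F) +
        2 * (√6 * Real.pi * τ)) := by
    field_simp
    ring
  rw [e]
  have d0 : 0 ≤ √3 * D / √2 := by positivity
  have f0 : 1.7 * F ≤ √3 * F := mul_le_mul_of_nonneg_right h3 hCf.le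
  have τ0 : 2.4 * 3.1 * τ ≤ √6 * Real.pi * τ := mul_le_mul_of_nonneg_right h6p (by linarith)
  have := mul_le_mul_of_nonneg_left (show 4 + 8 * F ≤ 4 * (√3 * D / √2) + 2 * F + 2 * (√3 * F) +
        2 * (√6 * Real.pi * τ) by linarith) hC
  linarith

theorem growthRate_nonneg (g : ℝ → ℝ) {ε : ℝ} (hε : 0 < ε) (hε' : ε < Real.pi / 2) :
    0 ≤ growthRate g ε := by
  linarith [two_mul_kernelLip_le_growthRate g hε hε', kernelLip_nonneg g hε hε']

theorem growthRate_pos {g : ℝ → ℝ} (hg : LocallyLipschitzOn (Ici 0) (derivWithin g (Ici 0)))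
    {ε : ℝ} (hε : 0 < ε) (hε' : ε < Real.pi / 2)
    (h : ∃ s ∈ Icc 0 ((Real.pi - 2 * ε) ^ 2), derivWithin g (Ici 0) s ≠ 0) :
    0 < growthRate g ε := by
  obtain ⟨s, hs, hs0⟩ := h
  have hC : 0 < supDerivG g ε :=
    (abs_pos.2 hs0).trans_le (abs_derivWithin_le_supDerivG hg hs)
  have hF := supRatio_pos hε hε'
  have hL := lipDerivG_nonneg g ε
  have : 0 < kernelLip g ε := by
    unfold kernelLip
    positivity
  linarith [two_mul_kernelLip_le_growthRate g hε hε']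

/-! ### The interaction field -/

/-- The gradient of `K_Q` at `R`, up to sign, in the left trivialization:
`2 g'(d²) (d / sin d) s`, where `s` is the axial vector of `Rᵀ Q`. -/
noncomputable def kernelVec (g : ℝ → ℝ) (R Q : SO3) : EuclideanSpace ℝ (Fin 3) :=
  (2 * derivWithin g (Ici 0) (geodDist R Q ^ 2)) •
    (angleRatio (geodDist R Q) • axial (R⁻¹ * Q : SO3).1)

theorem norm_angleRatio_smul_axial {R Q : SO3} (h : geodDist R Q < Real.pi) :
    ‖angleRatio (geodDist R Q) • axial (R⁻¹ * Q : SO3).1‖ = geodDist R Q := by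
  have h0 := geodDist_nonneg R Q
  rw [norm_smul, norm_axial_inv_mul, Real.norm_eq_abs, abs_of_pos (angleRatio_pos h0 h),
    angleRatio_mul_sin h0 h]

theorem norm_angleRatio_smul_sub_le {E : Type*} [NormedAddCommGroup E] [NormedSpace ℝ E]
    {v w : E} {a b δ C : ℝ} (ha0 : 0 ≤ a) (ha : a < Real.pi) (hb0 : 0 ≤ b) (hb : b < Real.pi)
    (hv : ‖v‖ = Real.sin a) (hab : |a - b| ≤ δ) (hvw : ‖v - w‖ ≤ δ) (hC : angleRatio b ≤ C) :
    ‖angleRatio a • v - angleRatio b • w‖ ≤ (1 + 2 * C) * δ := by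
  have hb1 := angleRatio_pos hb0 hb
  have hδ : 0 ≤ δ := (abs_nonneg _).trans hab
  have hs0 : 0 ≤ Real.sin a := Real.sin_nonneg_of_nonneg_of_le_pi ha0 ha.le
  have h1 : ‖(angleRatio a - angleRatio b) • v‖ ≤ δ + C * δ := by
    -- Since `f(θ) sin θ = θ`, the increment of `f` weighted by `sin a` is controlled by the
    -- Lipschitz bounds of the identity and of `sin`; no bound on `f'` enters.
    have e : (angleRatio a - angleRatio b) * Real.sin a =
        (a - b) + angleRatio b * (Real.sin b - Real.sin a) := by
      linear_combination angleRatio_mul_sin ha0 ha - angleRatio_mul_sin hb0 hb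
    rw [norm_smul, hv, Real.norm_eq_abs, ← abs_of_nonneg hs0, ← abs_mul, e]
    have hs : |Real.sin b - Real.sin a| ≤ δ := by
      have := Real.lipschitzWith_sin.dist_le_mul b a
      rw [Real.dist_eq, Real.dist_eq, abs_sub_comm b a] at this
      simpa using this.trans (by simpa using hab)
    calc _ ≤ |a - b| + |angleRatio b * (Real.sin b - Real.sin a)| := abs_add_le _ _
      _ ≤ δ + C * δ := by
        rw [abs_mul, abs_of_pos hb1]
        exact add_le_add hab (mul_le_mul hC hs (abs_nonneg _) (hb1.le.trans hC))
  have h2 : ‖angleRatio b • (v - w)‖ ≤ C * δ := by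
    rw [norm_smul, Real.norm_eq_abs, abs_of_pos hb1]
    exact mul_le_mul hC hvw (norm_nonneg _) (hb1.le.trans hC)
  have e : angleRatio a • v - angleRatio b • w =
      (angleRatio a - angleRatio b) • v + angleRatio b • (v - w) := by
    rw [sub_smul, smul_sub]
    abel
  rw [e]
  linarith [norm_add_le ((angleRatio a - angleRatio b) • v) (angleRatio b • (v - w))]

section Disk

variable {g : ℝ → ℝ} {ε : ℝ}

theorem geodDist_sq_mem {x y : SO3} (hε : 0 < ε) (hx : x ∈ diskEps ε) (hy : y ∈ diskEps ε) :
    geodDist x y ^ 2 ∈ Icc 0 ((Real.pi - 2 * ε) ^ 2) :=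
  ⟨sq_nonneg _, pow_le_pow_left₀ (geodDist_nonneg x y) (geodDist_lt_of_mem_diskEps hε hx hy).le 2⟩

theorem norm_kernelVec_le (hg : LocallyLipschitzOn (Ici 0) (derivWithin g (Ici 0))) (hε : 0 < ε)
    {x y : SO3} (hx : x ∈ diskEps ε) (hy : y ∈ diskEps ε) :
    ‖kernelVec g x y‖ ≤ 2 * supDerivG g ε * Real.pi := by
  have h := geodDist_lt_of_mem_diskEps hε hx hy
  have h1 := abs_derivWithin_le_supDerivG hg (geodDist_sq_mem hε hx hy)
  rw [kernelVec, norm_smul, norm_angleRatio_smul_axial (by linarith), Real.norm_eq_abs, abs_mul,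
    abs_two]
  exact mul_le_mul (by linarith) (geodDist_le_pi x y) (geodDist_nonneg x y)
    (by linarith [abs_nonneg (derivWithin g (Ici 0) (geodDist x y ^ 2))])

theorem norm_kernelVec_sub_le (hg : LocallyLipschitzOn (Ici 0) (derivWithin g (Ici 0)))
    (hε : 0 < ε) (hε' : ε < Real.pi / 2) {x x' y y' : SO3} (hx : x ∈ diskEps ε)
    (hx' : x' ∈ diskEps ε) (hy : y ∈ diskEps ε) (hy' : y' ∈ diskEps ε) :
    ‖kernelVec g x x' - kernelVec g y y'‖ ≤
      kernelLip g ε * (geodDist x y + geodDist x' y') := by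
  have hδ := abs_geodDist_sub_le hε hx hx' hy hy'
  have ha := geodDist_lt_of_mem_diskEps hε hx hx'
  have hb := geodDist_lt_of_mem_diskEps hε hy hy'
  have ha0 := geodDist_nonneg x x'
  have hb0 := geodDist_nonneg y y'
  have hlog := norm_angleRatio_smul_sub_le ha0 (by linarith) hb0 (by linarith)
    (norm_axial_inv_mul x x') hδ (norm_axial_sub_le x x' y y')
    (angleRatio_le_supRatio hε hε' hb0 hb.le)
  have hna := norm_angleRatio_smul_axial (R := x) (Q := x') (by linarith)
  have hG := abs_derivWithin_sub_le hg (geodDist_sq_mem hε hx hx') (geodDist_sq_mem hε hy hy')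
  have hC := abs_derivWithin_le_supDerivG hg (geodDist_sq_mem hε hy hy')
  have hL := lipDerivG_nonneg g ε
  unfold kernelVec kernelLip
  generalize angleRatio (geodDist x x') • axial (x⁻¹ * x' : SO3).1 = v at *
  generalize angleRatio (geodDist y y') • axial (y⁻¹ * y' : SO3).1 = w at *
  generalize geodDist x y + geodDist x' y' = δ at *
  have hδ0 : 0 ≤ δ := (abs_nonneg _).trans hδ
  -- The factor `2 π` bounds the sum of the two distances; together with `‖v‖ ≤ π` it produces the
  -- `4 π²` in `kernelLip`.
  have hsq : |geodDist x x' ^ 2 - geodDist y y' ^ 2| ≤ 2 * Real.pi * δ := by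
    rw [sq_sub_sq, abs_mul, abs_of_nonneg (by positivity)]
    exact mul_le_mul (by linarith) hδ (abs_nonneg _) (by positivity)
  generalize derivWithin g (Ici 0) (geodDist x x' ^ 2) = p at *
  generalize derivWithin g (Ici 0) (geodDist y y' ^ 2) = q at *
  have e : (2 * p) • v - (2 * q) • w = (2 * (p - q)) • v + (2 * q) • (v - w) := by
    module
  rw [e]
  refine (norm_add_le _ _).trans ?_
  rw [norm_smul, norm_smul, Real.norm_eq_abs, Real.norm_eq_abs, abs_mul, abs_mul, abs_two]
  have h1 : 2 * |p - q| * ‖v‖ ≤ 2 * (lipDerivG g ε * (2 * Real.pi * δ)) * Real.pi := by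
    rw [hna]
    refine mul_le_mul ?_ (by linarith) ha0 (by positivity)
    have := mul_le_mul_of_nonneg_left hsq hL
    linarith
  have h2 : 2 * |q| * ‖v - w‖ ≤ 2 * supDerivG g ε * ((1 + 2 * supRatio ε) * δ) :=
    mul_le_mul (by linarith) hlog (norm_nonneg _) (by linarith [abs_nonneg q])
  linarith

end Disk

/-! ### The gradient of the interaction potential -/

/-- Squaring removes the singularity of `arccos` at `1`, which corresponds to coinciding points. A
one-sided derivative suffices for the chain rule because `rotCos` never exceeds `1` on rotations. -/
theorem hasDerivWithinAt_arccos_sq {u : ℝ} (h0 : -1 < u) (h1 : u ≤ 1) :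
    HasDerivWithinAt (fun x => Real.arccos x ^ 2) (-2 * angleRatio (Real.arccos u)) (Iic 1) u := by
  have deriv_lt : ∀ x ∈ Ioo (-1 : ℝ) 1,
      HasDerivAt (fun x => Real.arccos x ^ 2) (-2 * angleRatio (Real.arccos x)) x := by
    intro x hx
    have hθ : Real.arccos x ≠ 0 := fun h => by
      have := Real.arccos_eq_zero.1 h
      linarith [hx.2]
    have e : -2 * angleRatio (Real.arccos x) =
        (2 : ℕ) * Real.arccos x ^ (2 - 1) * -(1 / √(1 - x ^ 2)) := by
      rw [angleRatio, if_neg hθ, Real.sin_arccos]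
      simp
      ring
    rw [e]
    exact (Real.hasDerivAt_arccos hx.1.ne' hx.2.ne).fun_pow 2
  rcases h1.lt_or_eq with h | rfl
  · exact (deriv_lt u ⟨h0, h⟩).hasDerivWithinAt
  · have hmem : Ioo (-1 : ℝ) 1 ∈ nhdsWithin (1 : ℝ) (Iio 1) := Ioo_mem_nhdsLT h0
    refine hasDerivWithinAt_Iic_of_tendsto_deriv
      (fun x hx => (deriv_lt x hx).differentiableAt.differentiableWithinAt)
      (Real.continuous_arccos.pow 2).continuousWithinAt hmem ?_
    have hc : ContinuousAt (fun x => -2 * angleRatio (Real.arccos x)) 1 := by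
      simp only [angleRatio_eq_inv_sinc]
      refine continuousAt_const.mul
        ((Real.continuous_sinc.comp Real.continuous_arccos).continuousAt.inv₀ ?_)
      simp
    refine (hc.tendsto.mono_left nhdsWithin_le_nhds).congr' ?_
    filter_upwards [hmem] with x hx using (deriv_lt x hx).deriv.symm

theorem hat_add (v w : EuclideanSpace ℝ (Fin 3)) : hat (v + w) = hat v + hat w := by
  ext i j
  fin_cases i <;> fin_cases j <;> simp [hat] <;> ring

/-- The hat map as a linear map. -/
def hatLinear : EuclideanSpace ℝ (Fin 3) →ₗ[ℝ] Matrix (Fin 3) (Fin 3) ℝ where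
  toFun := hat
  map_add' := hat_add
  map_smul' := hat_smul

open scoped Matrix.Norms.Operator in
theorem hasFDerivAt_exp_hat (ℓ : Matrix (Fin 3) (Fin 3) ℝ →ₗ[ℝ] ℝ) :
    HasFDerivAt (fun w => ℓ (NormedSpace.exp (hat w)))
      (LinearMap.toContinuousLinearMap (ℓ ∘ₗ hatLinear)) 0 := by
  have h1 : HasFDerivAt hat (LinearMap.toContinuousLinearMap hatLinear) 0 :=
    (LinearMap.toContinuousLinearMap hatLinear).hasFDerivAt
  have h2 : HasFDerivAt NormedSpace.exp
      (1 : Matrix (Fin 3) (Fin 3) ℝ →L[ℝ] Matrix (Fin 3) (Fin 3) ℝ) (hat 0) := by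
    rw [show hat 0 = 0 from map_zero hatLinear]
    exact hasFDerivAt_exp_zero
  exact ((LinearMap.toContinuousLinearMap ℓ).hasFDerivAt.comp 0 (h2.comp 0 h1))

theorem riemannExp_zero (R : SO3) : riemannExp R 0 = R := by
  have h : (⟨NormedSpace.exp (hat 0), exp_hat_mem 0⟩ : SO3) = 1 := by
    apply Subtype.ext
    change NormedSpace.exp (hat 0) = 1
    rw [show hat 0 = 0 from map_zero hatLinear, NormedSpace.exp_zero]
  rw [riemannExp, h, mul_one]

theorem hasGradientAt_rotCos_riemannExp (R Q : SO3) :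
    HasGradientAt (fun w => rotCos ((riemannExp R w)⁻¹ * Q : SO3).1)
      (axial (R⁻¹ * Q : SO3).1) 0 := by
  have h := (hasFDerivAt_exp_hat ((Matrix.traceLinearMap (Fin 3) ℝ ℝ) ∘ₗ
    LinearMap.mulLeft ℝ (R⁻¹ * Q : SO3).1.transpose)).sub_const 1 |>.mul_const (1 / 2)
  rw [hasGradientAt_iff_hasFDerivAt]
  refine (h.congr_of_eventuallyEq (Filter.Eventually.of_forall fun w => ?_)).congr_fderiv ?_
  · change rotCos ((riemannExp R w)⁻¹ * Q : SO3).1 =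
      (((R⁻¹ * Q : SO3).1.transpose * NormedSpace.exp (hat w)).trace - 1) * (1 / 2)
    have e : (riemannExp R w).1 = R.1 * NormedSpace.exp (hat w) := rfl
    rw [rotCos, coe_inv_mul, coe_inv_mul, e, ← Matrix.trace_transpose, Matrix.transpose_mul,
      Matrix.transpose_transpose, Matrix.transpose_mul, Matrix.transpose_transpose,
      ← mul_assoc]
    ring
  · ext w
    change (1 / 2 : ℝ) * ((R⁻¹ * Q : SO3).1.transpose * hat w).trace =
      inner ℝ (axial (R⁻¹ * Q : SO3).1) w
    rw [trace_mul_hat, axial_transpose, inner_neg_left]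
    ring

theorem riemannGrad_eq {K : SO3 → SO3 → ℝ} {g : ℝ → ℝ} (hK : IsInteractionPotential K g)
    {R Q : SO3} (h : geodDist R Q < Real.pi) :
    riemannGrad (fun P => K P Q) R = R.1 * hat (-kernelVec g R Q) := by
  have hu0 : -1 < rotCos (R⁻¹ * Q : SO3).1 := by
    rw [← cos_geodDist, ← Real.cos_pi]
    exact Real.cos_lt_cos_of_nonneg_of_le_pi (geodDist_nonneg R Q) le_rfl h
  have h1 := hasDerivWithinAt_arccos_sq hu0 (abs_le.1 (abs_rotCos_le_one (R⁻¹ * Q))).2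
  rw [← geodDist_eq] at h1
  have h2 : HasDerivWithinAt g (derivWithin g (Ici 0) (geodDist R Q ^ 2)) (Ici 0)
      (Real.arccos (rotCos (R⁻¹ * Q : SO3).1) ^ 2) := by
    rw [← geodDist_eq]
    exact (hK.differentiable _ (mem_Ici.2 (sq_nonneg (geodDist R Q)))).hasDerivWithinAt
  have h3 := h2.comp (rotCos (R⁻¹ * Q : SO3).1) h1 fun x _ => mem_Ici.2 (sq_nonneg _)
  have h4 := h3.comp_hasFDerivAt_of_eq 0 (hasGradientAt_rotCos_riemannExp R Q).hasFDerivAt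
    (Filter.Eventually.of_forall fun w => (abs_le.1 (abs_rotCos_le_one _)).2)
    (by rw [riemannExp_zero])
  have h5 : HasGradientAt (fun w => K (riemannExp R w) Q) (-kernelVec g R Q) 0 := by
    rw [hasGradientAt_iff_hasFDerivAt]
    refine (h4.congr_of_eventuallyEq (Filter.Eventually.of_forall fun w => ?_)).congr_fderiv ?_
    · rw [hK.eq_comp, geodDist_eq]
      rfl
    · ext w
      simp only [kernelVec, InnerProductSpace.toDual_apply_apply, smul_apply,
        smul_eq_mul, inner_neg_left, real_inner_smul_left]
      ring
  rw [riemannGrad, h5.gradient]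

/-! ### An averaged Grönwall inequality -/

/-- Only `D²` is differentiable, as `D` may have a corner where it vanishes. The Grönwall argument
is run on `√(D² + δ²)`, which obeys the same differential inequality, and then `δ → 0`. -/
theorem exp_neg_mul_le_add_of_deriv_sq_le {D H h : ℝ → ℝ} {Λ T : ℝ} (hΛ : 0 ≤ Λ)
    (hD0 : ∀ t, 0 ≤ D t) (hh0 : ∀ t, 0 ≤ h t) (hD : ContinuousOn D (Icc 0 T)) (hH0 : H 0 = 0)
    (hH : ∀ t, HasDerivAt H (Λ * Real.exp (-Λ * t) * h t) t)
    (hq : ∀ t ∈ Ioo 0 T, ∃ q, HasDerivAt (fun s => D s ^ 2) q t ∧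
      q ≤ 2 * D t * (Λ * (D t + h t))) {t : ℝ} (ht : t ∈ Icc 0 T) :
    Real.exp (-Λ * t) * D t ≤ D 0 + H t := by
  refine le_of_forall_pos_le_add fun δ hδ => ?_
  have hpos : ∀ s, 0 < D s ^ 2 + δ ^ 2 := fun s => by positivity
  have anti : AntitoneOn (fun s => Real.exp (-Λ * s) * √(D s ^ 2 + δ ^ 2) - H s) (Icc 0 T) := by
    have hder : ∀ s ∈ Ioo 0 T, ∃ p, HasDerivAt
        (fun s => Real.exp (-Λ * s) * √(D s ^ 2 + δ ^ 2) - H s) p s ∧ p ≤ 0 := by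
      intro s hs
      obtain ⟨q, hq1, hq2⟩ := hq s hs
      have he : HasDerivAt (fun s => Real.exp (-Λ * s)) (Real.exp (-Λ * s) * (-Λ * 1)) s :=
        ((hasDerivAt_id s).const_mul (-Λ)).exp
      refine ⟨_, (he.mul ((hq1.add_const (δ ^ 2)).sqrt (hpos s).ne')).sub (hH s), ?_⟩
      have hE : 0 < √(D s ^ 2 + δ ^ 2) := Real.sqrt_pos.2 (hpos s)
      have hDE : D s ≤ √(D s ^ 2 + δ ^ 2) :=
        Real.le_sqrt_of_sq_le (by linarith [sq_nonneg δ])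
      have hqE : q / (2 * √(D s ^ 2 + δ ^ 2)) ≤ Λ * (√(D s ^ 2 + δ ^ 2) + h s) := by
        rw [div_le_iff₀ (by positivity)]
        refine hq2.trans ?_
        have h1 : D s * (D s + h s) ≤ √(D s ^ 2 + δ ^ 2) * (√(D s ^ 2 + δ ^ 2) + h s) :=
          mul_le_mul hDE (by linarith) (add_nonneg (hD0 s) (hh0 s)) hE.le
        nlinarith [mul_le_mul_of_nonneg_left h1 hΛ]
      have := mul_le_mul_of_nonneg_left hqE (Real.exp_pos (-Λ * s)).le
      linarith
    refine antitoneOn_of_deriv_nonpos (convex_Icc 0 T) ?_ ?_ ?_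
    · have hHc : Continuous H := continuous_iff_continuousAt.2 fun s => (hH s).continuousAt
      have hec : Continuous fun s => Real.exp (-Λ * s) := by fun_prop
      exact (hec.continuousOn.mul ((hD.pow 2).add continuousOn_const).sqrt).sub hHc.continuousOn
    · intro s hs
      rw [interior_Icc] at hs
      obtain ⟨p, hp, -⟩ := hder s hs
      exact hp.differentiableAt.differentiableWithinAt
    · intro s hs
      rw [interior_Icc] at hs
      obtain ⟨p, hp, hp0⟩ := hder s hs
      rwa [hp.deriv]
  have h0 := anti (left_mem_Icc.2 (ht.1.trans ht.2)) ht ht.1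
  simp only [mul_zero, Real.exp_zero, one_mul, hH0, sub_zero] at h0
  have h1 : √(D 0 ^ 2 + δ ^ 2) ≤ D 0 + δ :=
    Real.sqrt_le_iff.2 ⟨add_nonneg (hD0 0) hδ.le, by nlinarith [hD0 0]⟩
  have h2 : Real.exp (-Λ * t) * D t ≤ Real.exp (-Λ * t) * √(D t ^ 2 + δ ^ 2) :=
    mul_le_mul_of_nonneg_left (Real.le_sqrt_of_sq_le (by linarith [sq_nonneg δ]))
      (Real.exp_pos _).le
  linarith

/-- The pathwise bound is integrated over `ω`, so the average `h` is never differentiated; its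
continuity comes from dominated convergence. A second Grönwall step then closes the resulting
integral inequality for `h`, and each step costs one factor `exp(Λ t)`. -/
theorem integral_le_exp_mul_integral {Ω : Type*} [MeasurableSpace Ω] {μ : Measure Ω}
    [IsProbabilityMeasure μ] {D : Ω → ℝ → ℝ} {Λ T M : ℝ} (hΛ : 0 ≤ Λ) (hT : 0 ≤ T)
    (hD0 : ∀ ω t, 0 ≤ D ω t) (hDM : ∀ ω t, D ω t ≤ M)
    (hmeas : ∀ t ∈ Icc 0 T, AEStronglyMeasurable (fun ω => D ω t) μ)
    (hcont : ∀ᵐ ω ∂μ, ContinuousOn (D ω) (Icc 0 T))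
    (hq : ∀ᵐ ω ∂μ, ∀ t ∈ Ioo 0 T, ∃ q, HasDerivAt (fun s => D ω s ^ 2) q t ∧
      q ≤ 2 * D ω t * (Λ * (D ω t + ∫ ω', D ω' t ∂μ))) {t : ℝ} (ht : t ∈ Icc 0 T) :
    ∫ ω, D ω t ∂μ ≤ Real.exp (2 * Λ * t) * ∫ ω, D ω 0 ∂μ := by
  have hbound : ∀ ω s, ‖D ω s‖ ≤ M := fun ω s => by
    rw [Real.norm_eq_abs, abs_of_nonneg (hD0 ω s)]
    exact hDM ω s
  have hint : ∀ s ∈ Icc 0 T, Integrable (fun ω => D ω s) μ := fun s hs =>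
    Integrable.of_bound (hmeas s hs) M (Filter.Eventually.of_forall fun ω => hbound ω s)
  have hc : ContinuousOn (fun s => ∫ ω, D ω s ∂μ) (Icc 0 T) :=
    continuousOn_of_dominated hmeas
      (fun s _ => Filter.Eventually.of_forall fun ω => hbound ω s) (integrable_const M) hcont
  -- The average is extended by constants outside `[0, T]`, so that its primitive `H` is
  -- differentiable at every real point.
  obtain ⟨h, hhdef⟩ : ∃ h : ℝ → ℝ,
      h = IccExtend hT ((Icc 0 T).domRestrict fun s => ∫ ω, D ω s ∂μ) := ⟨_, rfl⟩
  have hh : ∀ s ∈ Icc 0 T, h s = ∫ ω, D ω s ∂μ := fun s hs => by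
    rw [hhdef, IccExtend_of_mem hT _ hs, domRestrict_apply]
  have hhc : Continuous h := by
    rw [hhdef]
    exact (continuousOn_iff_continuous_domRestrict.1 hc).Icc_extend'
  have hh0 : ∀ s, 0 ≤ h s := fun s => by
    rw [hhdef]
    exact integral_nonneg fun ω => hD0 ω _
  obtain ⟨H, hHdef⟩ : ∃ H : ℝ → ℝ,
      H = fun s => ∫ r in (0 : ℝ)..s, Λ * Real.exp (-Λ * r) * h r := ⟨_, rfl⟩
  have hH0 : H 0 = 0 := by simp [hHdef]
  have hH : ∀ s, HasDerivAt H (Λ * Real.exp (-Λ * s) * h s) s := fun s => by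
    rw [hHdef]
    exact ((by fun_prop : Continuous fun r => Λ * Real.exp (-Λ * r) * h r).integral_hasStrictDerivAt
      0 s).hasDerivAt
  have avg : ∀ s ∈ Icc 0 T, Real.exp (-Λ * s) * h s ≤ h 0 + H s := by
    intro s hs
    have h00 : (0 : ℝ) ∈ Icc 0 T := left_mem_Icc.2 hT
    rw [hh s hs, hh 0 h00, ← integral_const_mul]
    have e : (∫ ω, D ω 0 ∂μ) + H s = ∫ ω, (D ω 0 + H s) ∂μ := by
      rw [integral_add (hint 0 h00) (integrable_const _)]
      simp
    rw [e]
    refine integral_mono_ae ((hint s hs).const_mul _) ((hint 0 h00).add (integrable_const _)) ?_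
    filter_upwards [hcont, hq] with ω hω1 hω2
    refine exp_neg_mul_le_add_of_deriv_sq_le hΛ (hD0 ω) hh0 hω1 hH0 hH (fun r hr => ?_) hs
    rw [hh r (Ioo_subset_Icc_self hr)]
    exact hω2 r hr
  -- By `avg`, the derivative of `h 0 + H` is at most `Λ (h 0 + H)`.
  have anti : AntitoneOn (fun s => Real.exp (-Λ * s) * (h 0 + H s)) (Icc 0 T) := by
    have hder : ∀ s, HasDerivAt (fun s => Real.exp (-Λ * s) * (h 0 + H s))
        (Real.exp (-Λ * s) * (-Λ * 1) * (h 0 + H s) +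
          Real.exp (-Λ * s) * (Λ * Real.exp (-Λ * s) * h s)) s := fun s =>
      (((hasDerivAt_id s).const_mul (-Λ)).exp).mul ((hH s).const_add (h 0))
    refine antitoneOn_of_deriv_nonpos (convex_Icc 0 T)
      (fun s _ => (hder s).continuousAt.continuousWithinAt)
      (fun s _ => (hder s).differentiableAt.differentiableWithinAt) fun s hs => ?_
    rw [(hder s).deriv]
    have := mul_le_mul_of_nonneg_left (avg s (interior_subset hs))
      (mul_nonneg (Real.exp_pos (-Λ * s)).le hΛ)
    linarith
  have h1 := anti (left_mem_Icc.2 hT) ht ht.1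
  simp only [mul_zero, Real.exp_zero, one_mul, hH0, add_zero] at h1
  have h2 := avg t ht
  rw [← hh t ht, ← hh 0 (left_mem_Icc.2 hT)]
  have h3 : Real.exp (2 * Λ * t) * (Real.exp (-Λ * t) * Real.exp (-Λ * t)) = 1 := by
    rw [← Real.exp_add, ← Real.exp_add, ← Real.exp_zero]
    congr 1
    ring
  have h4 : Real.exp (-Λ * t) * (Real.exp (-Λ * t) * h t) ≤ h 0 :=
    (mul_le_mul_of_nonneg_left h2 (Real.exp_pos _).le).trans h1
  calc h t = Real.exp (2 * Λ * t) * (Real.exp (-Λ * t) * (Real.exp (-Λ * t) * h t)) := by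
        linear_combination (-h t) * h3
    _ ≤ Real.exp (2 * Λ * t) * h 0 := mul_le_mul_of_nonneg_left h4 (Real.exp_pos _).le

/-! ### The mean field and the flows -/

theorem trace_transpose_mul (A B : Matrix (Fin 3) (Fin 3) ℝ) :
    (A.transpose * B).trace = ∑ i, ∑ k, A k i * B k i := by
  simp [Matrix.trace, Matrix.mul_apply]

/-- Cyclicity of the trace lets the same axial vector of `xᵀ y` account for the motion of both
endpoints, so only `b - a` appears. -/
theorem hasDerivAt_geodDist_sq {x y : ℝ → SO3} {a b : EuclideanSpace ℝ (Fin 3)} {t : ℝ}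
    (hx : ∀ i j, HasDerivAt (fun s => (x s).1 i j) (((x t).1 * hat a) i j) t)
    (hy : ∀ i j, HasDerivAt (fun s => (y s).1 i j) (((y t).1 * hat b) i j) t)
    (h : geodDist (x t) (y t) < Real.pi) :
    HasDerivAt (fun s => geodDist (x s) (y s) ^ 2)
      (2 * inner ℝ (angleRatio (geodDist (x t) (y t)) • axial ((x t)⁻¹ * y t : SO3).1) (b - a))
      t := by
  have h0 : -1 < rotCos ((x t)⁻¹ * y t : SO3).1 := by
    rw [← cos_geodDist, ← Real.cos_pi]
    exact Real.cos_lt_cos_of_nonneg_of_le_pi (geodDist_nonneg _ _) le_rfl h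
  have h1 := hasDerivWithinAt_arccos_sq h0 (abs_le.1 (abs_rotCos_le_one ((x t)⁻¹ * y t))).2
  rw [← geodDist_eq] at h1
  have h2 : HasDerivAt (fun s => rotCos ((x s)⁻¹ * y s : SO3).1)
      (-inner ℝ (axial ((x t)⁻¹ * y t : SO3).1) (b - a)) t := by
    have hs : HasDerivAt (fun s => ((∑ i, ∑ k, (x s).1 k i * (y s).1 k i) - 1) / 2)
        ((∑ i, ∑ k, (((x t).1 * hat a) k i * (y t).1 k i +
          (x t).1 k i * ((y t).1 * hat b) k i)) / 2) t :=
      ((HasDerivAt.fun_sum fun i _ => HasDerivAt.fun_sum fun k _ =>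
        (hx k i).mul (hy k i)).sub_const 1).div_const 2
    convert hs using 1
    · funext s
      rw [rotCos, coe_inv_mul, trace_transpose_mul]
    · simp only [Finset.sum_add_distrib]
      rw [← trace_transpose_mul, ← trace_transpose_mul, Matrix.transpose_mul, hat_transpose,
        ← mul_assoc, mul_assoc, ← coe_inv_mul, trace_mul_hat, Matrix.trace_mul_comm, mul_neg,
        Matrix.trace_neg, trace_mul_hat, inner_sub_right]
      ring
  refine (h1.comp_hasDerivAt_of_eq t h2
    (Filter.Eventually.of_forall fun s => (abs_le.1 (abs_rotCos_le_one _)).2)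
    rfl).congr_deriv ?_ |>.congr_of_eventuallyEq (Filter.Eventually.of_forall fun s => ?_)
  · rw [real_inner_smul_left]
    ring
  · simp only [Function.comp, geodDist_eq]

section Disk

variable {g : ℝ → ℝ} {ε : ℝ}

theorem continuous_kernelVec (hg : LocallyLipschitzOn (Ici 0) (derivWithin g (Ici 0)))
    (hε : 0 < ε) (hε' : ε < Real.pi / 2) (x : diskEps ε) :
    Continuous fun y : diskEps ε => kernelVec g x y := by
  refine continuous_iff_continuousAt.2 fun y => ?_
  rw [ContinuousAt, tendsto_iff_norm_sub_tendsto_zero]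
  have hc : Continuous fun z : diskEps ε => kernelLip g ε * (geodDist x x + geodDist z y) :=
    (continuous_const.add (continuous_geodDist
      continuous_subtype_val continuous_const)).const_mul _
  have h0 := hc.tendsto y
  have e : kernelLip g ε * (geodDist x x + geodDist y y) = 0 := by
    rw [geodDist_self, geodDist_self, add_zero, mul_zero]
  rw [e] at h0
  exact squeeze_zero (fun _ => norm_nonneg _)
    (fun z => norm_kernelVec_sub_le hg hε hε' x.2 z.2 x.2 y.2) h0

theorem integrable_kernelVec (hg : LocallyLipschitzOn (Ici 0) (derivWithin g (Ici 0)))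
    (hε : 0 < ε) (hε' : ε < Real.pi / 2) (x : diskEps ε) {Ω : Type*} [MeasurableSpace Ω]
    {μ : Measure Ω} [IsProbabilityMeasure μ] {φ : Ω → diskEps ε} (hφ : AEMeasurable φ μ) :
    Integrable (fun ω => kernelVec g x (φ ω)) μ :=
  Integrable.of_bound
    ((continuous_kernelVec hg hε hε' x).measurable.comp_aemeasurable hφ).aestronglyMeasurable _
    (Filter.Eventually.of_forall fun ω => norm_kernelVec_le hg hε x.2 (φ ω).2)

theorem velocity_eq {K : SO3 → SO3 → ℝ} (hK : IsInteractionPotential K g) (hε : 0 < ε)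
    (hε' : ε < Real.pi / 2) (ρ : ℝ → ProbabilityMeasure (diskEps ε)) (x : diskEps ε) (t : ℝ) :
    velocity K ρ x t =
      x.1.1 * hat (∫ Q : diskEps ε, kernelVec g x Q ∂(ρ t : Measure (diskEps ε))) := by
  have hg := hK.deriv_locallyLipschitz
  ext i j
  obtain ⟨ℓ, hℓ⟩ : ∃ ℓ : EuclideanSpace ℝ (Fin 3) →L[ℝ] ℝ, ∀ v, ℓ v = (x.1.1 * hat v) i j :=
    ⟨LinearMap.toContinuousLinearMap (LinearMap.proj j ∘ₗ LinearMap.proj i ∘ₗ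
      LinearMap.mulLeft ℝ x.1.1 ∘ₗ hatLinear), fun v => rfl⟩
  have hint : Integrable (fun Q : diskEps ε => kernelVec g x Q) (ρ t : Measure (diskEps ε)) :=
    integrable_kernelVec hg hε hε' x aemeasurable_id
  rw [← hℓ, ← ℓ.integral_comp_comm hint, velocity, Matrix.of_apply, ← integral_neg]
  refine integral_congr_ae (Filter.Eventually.of_forall fun Q => ?_)
  have hd := geodDist_lt_of_mem_diskEps hε x.2 Q.2
  simp only
  rw [riemannGrad_eq hK (by linarith), ← hℓ, map_neg, neg_neg]

end Disk

instance : SecondCountableTopology SO3 :=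
  haveI : SecondCountableTopology (Matrix (Fin 3) (Fin 3) ℝ) :=
    inferInstanceAs (SecondCountableTopology (Fin 3 → Fin 3 → ℝ))
  inferInstanceAs (SecondCountableTopology
    (Matrix.specialOrthogonalGroup (Fin 3) ℝ : Set (Matrix (Fin 3) (Fin 3) ℝ)))

theorem continuous_geodDist_coe {U : Set SO3} :
    Continuous fun p : U × U => geodDist p.1 p.2 :=
  continuous_geodDist (continuous_subtype_val.comp continuous_fst)
    (continuous_subtype_val.comp continuous_snd)

section Flow

variable {g : ℝ → ℝ} {ε : ℝ} {K : SO3 → SO3 → ℝ} {T : EReal} {T₁ : ℝ}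

theorem mem_timeInterval (hT : (T₁ : EReal) < T) {t : ℝ} (ht : t ∈ Icc 0 T₁) :
    t ∈ timeInterval T :=
  ⟨ht.1, (EReal.coe_le_coe_iff.2 ht.2).trans_lt hT⟩

theorem IsFlowMap.hasDerivAt {U : Set SO3} {X : U → ℝ → Matrix (Fin 3) (Fin 3) ℝ} {S : Set U}
    {Ψ : U → ℝ → U} (h : IsFlowMap X S T Ψ) (hT : (T₁ : EReal) < T) {R : U} (hR : R ∈ S) {t : ℝ}
    (ht : t ∈ Ioo 0 T₁) (i j : Fin 3) :
    HasDerivAt (fun s => (Ψ R s).1.1 i j) (X (Ψ R t) t i j) t :=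
  ((h R hR).2 t (mem_timeInterval hT (Ioo_subset_Icc_self ht)) i j).hasDerivAt
    (Filter.mem_of_superset (Icc_mem_nhds ht.1 ht.2) fun _ hs => mem_timeInterval hT hs)

theorem IsFlowMap.continuousOn {U : Set SO3} {X : U → ℝ → Matrix (Fin 3) (Fin 3) ℝ} {S : Set U}
    {Ψ : U → ℝ → U} (h : IsFlowMap X S T Ψ) (hT : (T₁ : EReal) < T) {R : U} (hR : R ∈ S) :
    ContinuousOn (fun s => (Ψ R s).1) (Icc 0 T₁) := by
  refine Topology.IsInducing.subtypeVal.continuousOn_iff.2 ?_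
  refine continuousOn_pi.2 fun i => continuousOn_pi.2 fun j => fun t ht => ?_
  exact ((h R hR).2 t (mem_timeInterval hT ht) i j).continuousWithinAt.mono
    fun _ hs => mem_timeInterval hT hs

variable {ρ σ : ℝ → ProbabilityMeasure (diskEps ε)}
  {γ : ProbabilityMeasure (diskEps ε × diskEps ε)}

/-- Pulling both mean fields back to the common space of `γ` makes their difference a single
integral, to which the Lipschitz bound for `kernelVec` applies pointwise. -/
theorem exists_hasDerivAt_geodDist_sq_le (hK : IsInteractionPotential K g) (hε : 0 < ε)
    (hε' : ε < Real.pi / 2) {φ ψ : diskEps ε × diskEps ε → diskEps ε}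
    (hφ : AEMeasurable φ (γ : Measure (diskEps ε × diskEps ε)))
    (hψ : AEMeasurable ψ (γ : Measure (diskEps ε × diskEps ε))) {x y : ℝ → diskEps ε} {t : ℝ}
    (hρ : (ρ t : Measure (diskEps ε)) = (γ : Measure (diskEps ε × diskEps ε)).map φ)
    (hσ : (σ t : Measure (diskEps ε)) = (γ : Measure (diskEps ε × diskEps ε)).map ψ)
    (hx : ∀ i j, HasDerivAt (fun s => (x s).1.1 i j) (velocity K ρ (x t) t i j) t)
    (hy : ∀ i j, HasDerivAt (fun s => (y s).1.1 i j) (velocity K σ (y t) t i j) t) :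
    ∃ q, HasDerivAt (fun s => geodDist (x s) (y s) ^ 2) q t ∧
      q ≤ 2 * geodDist (x t) (y t) * (kernelLip g ε * (geodDist (x t) (y t) +
        ∫ p, geodDist (φ p) (ψ p) ∂(γ : Measure (diskEps ε × diskEps ε)))) := by
  have hg := hK.deriv_locallyLipschitz
  have hd := geodDist_lt_of_mem_diskEps hε (x t).2 (y t).2
  rw [velocity_eq hK hε hε'] at hx hy
  refine ⟨_, hasDerivAt_geodDist_sq hx hy (by linarith), ?_⟩
  rw [mul_assoc]
  refine mul_le_mul_of_nonneg_left ?_ zero_le_two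
  refine (real_inner_le_norm _ _).trans ?_
  rw [norm_angleRatio_smul_axial (by linarith)]
  refine mul_le_mul_of_nonneg_left ?_ (geodDist_nonneg _ _)
  have hcx := (continuous_kernelVec hg hε hε' (x t)).aestronglyMeasurable
    (μ := (γ : Measure (diskEps ε × diskEps ε)).map φ)
  have hcy := (continuous_kernelVec hg hε hε' (y t)).aestronglyMeasurable
    (μ := (γ : Measure (diskEps ε × diskEps ε)).map ψ)
  have hdist : Integrable (fun p => geodDist (φ p) (ψ p))
      (γ : Measure (diskEps ε × diskEps ε)) := by
    refine Integrable.of_bound (C := Real.pi) ?_ (Filter.Eventually.of_forall fun p => ?_)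
    · exact (continuous_geodDist_coe.measurable.comp_aemeasurable
        (hφ.prodMk hψ)).aestronglyMeasurable
    · rw [Real.norm_eq_abs, abs_of_nonneg (geodDist_nonneg _ _)]
      exact geodDist_le_pi _ _
  rw [hρ, hσ, integral_map hφ hcx, integral_map hψ hcy, ← integral_sub
    (integrable_kernelVec hg hε hε' _ hψ) (integrable_kernelVec hg hε hε' _ hφ)]
  have e : kernelLip g ε * (geodDist (x t) (y t) +
        ∫ p, geodDist (φ p) (ψ p) ∂(γ : Measure (diskEps ε × diskEps ε))) =
      ∫ p, kernelLip g ε * (geodDist (x t) (y t) + geodDist (φ p) (ψ p))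
        ∂(γ : Measure (diskEps ε × diskEps ε)) := by
    rw [integral_const_mul, integral_add (integrable_const _) hdist]
    simp
  rw [e]
  refine norm_integral_le_of_norm_le (((integrable_const _).add hdist).const_mul _)
    (Filter.Eventually.of_forall fun p => ?_)
  rw [norm_sub_rev]
  exact norm_kernelVec_sub_le hg hε hε' (x t).2 (φ p).2 (y t).2 (ψ p).2

/-! ### Couplings and the Wasserstein estimate -/

theorem wasserstein_bddBelow {U : Set SO3} (μ ν : ProbabilityMeasure U) :
    BddBelow {c : ℝ | ∃ γ : ProbabilityMeasure (U × U),
      (γ : Measure (U × U)).map Prod.fst = (μ : Measure U) ∧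
      (γ : Measure (U × U)).map Prod.snd = (ν : Measure U) ∧
      c = ∫ p : U × U, geodDist p.1 p.2 ∂(γ : Measure (U × U))} := by
  refine ⟨0, ?_⟩
  rintro _ ⟨γ, -, -, rfl⟩
  exact integral_nonneg fun p => geodDist_nonneg _ _

theorem le_wasserstein {U : Set SO3} {μ ν : ProbabilityMeasure U} {c : ℝ}
    (h : ∀ γ : ProbabilityMeasure (U × U), (γ : Measure (U × U)).map Prod.fst = (μ : Measure U) →
      (γ : Measure (U × U)).map Prod.snd = (ν : Measure U) →
      c ≤ ∫ p : U × U, geodDist p.1 p.2 ∂(γ : Measure (U × U))) : c ≤ wasserstein μ ν := by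
  -- The product coupling shows that the set of costs is nonempty; otherwise its real infimum would
  -- be the default value `0`.
  refine le_csInf ⟨∫ p : U × U, geodDist p.1 p.2 ∂(μ.prod ν : Measure (U × U)), μ.prod ν, ?_, ?_,
    ?_⟩ ?_
  · rw [ProbabilityMeasure.toMeasure_prod, Measure.map_fst_prod, measure_univ, one_smul]
  · rw [ProbabilityMeasure.toMeasure_prod, Measure.map_snd_prod, measure_univ, one_smul]
  · rfl
  · rintro _ ⟨γ, h1, h2, rfl⟩
    exact h γ h1 h2

theorem wasserstein_le_exp_mul_wasserstein (hK : IsInteractionPotential K g) (hε : 0 < ε)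
    (hε' : ε < Real.pi / 2) (hT : (T₁ : EReal) < T) (hρ : IsWeakSolution K T ρ)
    (hσ : IsWeakSolution K T σ) {t : ℝ} (ht : t ∈ Icc 0 T₁) :
    wasserstein (ρ t) (σ t) ≤ Real.exp (2 * kernelLip g ε * t) * wasserstein (ρ 0) (σ 0) := by
  obtain ⟨Φ, hΦ, -, hΦρ⟩ := hρ
  obtain ⟨Ψ, hΨ, -, hΨσ⟩ := hσ
  rw [← div_le_iff₀' (Real.exp_pos _)]
  refine le_wasserstein fun γ h1 h2 => ?_
  rw [div_le_iff₀' (Real.exp_pos _)]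
  have hφm : ∀ s ∈ Icc 0 T₁, AEMeasurable (fun p => Φ p.1 s)
      (γ : Measure (diskEps ε × diskEps ε)) := fun s hs => by
    have h := (hΦρ s (mem_timeInterval hT hs)).1
    rw [← h1] at h
    exact h.comp_measurable measurable_fst
  have hψm : ∀ s ∈ Icc 0 T₁, AEMeasurable (fun p => Ψ p.2 s)
      (γ : Measure (diskEps ε × diskEps ε)) := fun s hs => by
    have h := (hΨσ s (mem_timeInterval hT hs)).1
    rw [← h2] at h
    exact h.comp_measurable measurable_snd
  have hρm : ∀ s ∈ Icc 0 T₁, (ρ s : Measure (diskEps ε)) =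
      (γ : Measure (diskEps ε × diskEps ε)).map fun p => Φ p.1 s := fun s hs => by
    obtain ⟨h, e⟩ := hΦρ s (mem_timeInterval hT hs)
    rw [← h1] at h e
    rw [e, AEMeasurable.map_map_of_aemeasurable h measurable_fst.aemeasurable]
    rfl
  have hσm : ∀ s ∈ Icc 0 T₁, (σ s : Measure (diskEps ε)) =
      (γ : Measure (diskEps ε × diskEps ε)).map fun p => Ψ p.2 s := fun s hs => by
    obtain ⟨h, e⟩ := hΨσ s (mem_timeInterval hT hs)
    rw [← h2] at h e
    rw [e, AEMeasurable.map_map_of_aemeasurable h measurable_snd.aemeasurable]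
    rfl
  -- The flows are controlled only on the supports of the initial measures, which carry the
  -- marginals of `γ`.
  have hR : ∀ᵐ p ∂(γ : Measure (diskEps ε × diskEps ε)),
      p.1 ∈ (ρ 0 : Measure (diskEps ε)).support := by
    refine ae_of_ae_map measurable_fst.aemeasurable ?_
    rw [h1]
    exact Measure.support_mem_ae
  have hQ : ∀ᵐ p ∂(γ : Measure (diskEps ε × diskEps ε)),
      p.2 ∈ (σ 0 : Measure (diskEps ε)).support := by
    refine ae_of_ae_map measurable_snd.aemeasurable ?_
    rw [h2]
    exact Measure.support_mem_ae
  have hdist : Continuous fun p : diskEps ε × diskEps ε => geodDist p.1 p.2 :=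
    continuous_geodDist_coe
  have main := integral_le_exp_mul_integral (μ := (γ : Measure (diskEps ε × diskEps ε)))
    (D := fun p s => geodDist (Φ p.1 s) (Ψ p.2 s)) (M := Real.pi) (kernelLip_nonneg g hε hε')
    (ht.1.trans ht.2) (fun _ _ => geodDist_nonneg _ _) (fun _ _ => geodDist_le_pi _ _)
    (fun s hs => (hdist.measurable.comp_aemeasurable
      ((hφm s hs).prodMk (hψm s hs))).aestronglyMeasurable) ?_ ?_ ht
  · have e0 : ∫ p, geodDist (Φ p.1 0) (Ψ p.2 0) ∂(γ : Measure (diskEps ε × diskEps ε)) =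
        ∫ p, geodDist p.1 p.2 ∂(γ : Measure (diskEps ε × diskEps ε)) := by
      refine integral_congr_ae ?_
      filter_upwards [hR, hQ] with p hp1 hp2
      rw [(hΦ p.1 hp1).1, (hΨ p.2 hp2).1]
    rw [e0] at main
    refine le_trans (csInf_le (wasserstein_bddBelow _ _) ?_) main
    have hpair := (hφm t ht).prodMk (hψm t ht)
    refine ⟨γ.map hpair, ?_, ?_, ?_⟩
    · rw [ProbabilityMeasure.toMeasure_map, AEMeasurable.map_map_of_aemeasurable
        measurable_fst.aemeasurable hpair, hρm t ht]
      rfl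
    · rw [ProbabilityMeasure.toMeasure_map, AEMeasurable.map_map_of_aemeasurable
        measurable_snd.aemeasurable hpair, hσm t ht]
      rfl
    · rw [ProbabilityMeasure.toMeasure_map, integral_map hpair hdist.aestronglyMeasurable]
  · filter_upwards [hR, hQ] with p hp1 hp2
    exact continuousOn_iff_continuous_domRestrict.2 (continuous_geodDist
      (hΦ.continuousOn hT hp1).domRestrict (hΨ.continuousOn hT hp2).domRestrict)
  · filter_upwards [hR, hQ] with p hp1 hp2 s hs
    have hs' := Ioo_subset_Icc_self hs
    exact exists_hasDerivAt_geodDist_sq_le hK hε hε' (hφm s hs') (hψm s hs') (hρm s hs')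
      (hσm s hs') (x := Φ p.1) (y := Ψ p.2) (fun i j => hΦ.hasDerivAt hT hp1 hs i j)
      fun i j => hΨ.hasDerivAt hT hp2 hs i j

theorem wasserstein_nonneg {U : Set SO3} (μ ν : ProbabilityMeasure U) : 0 ≤ wasserstein μ ν := by
  refine Real.sInf_nonneg ?_
  rintro _ ⟨γ, -, -, rfl⟩
  exact integral_nonneg fun p => geodDist_nonneg _ _

end Flow

theorem mainTheorem6 (ε : ℝ) (hε : 0 < ε) (hε' : ε < Real.pi / 2)
    (K : SO3 → SO3 → ℝ) (g : ℝ → ℝ) (hK : IsInteractionPotential K g) :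
    growthFactor g ε 0 = 1 ∧
    Monotone (growthFactor g ε) ∧
    ((∃ s ∈ Set.Icc 0 ((Real.pi - 2 * ε) ^ 2), derivWithin g (Set.Ici 0) s ≠ 0) →
      StrictMono (growthFactor g ε)) ∧
    ∀ T : EReal, 0 < T →
      ∀ ρ σ : ℝ → MeasureTheory.ProbabilityMeasure (diskEps ε),
        IsWeakSolution K T ρ → IsWeakSolution K T σ →
        ∃ Tstar : ℝ, 0 < Tstar ∧ (Tstar : EReal) < T ∧
          BddAbove (growthFactor g ε '' Set.Ico 0 Tstar) ∧
          ∀ t ∈ Set.Ico 0 Tstar,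
            wasserstein (ρ t) (σ t) ≤ growthFactor g ε t * wasserstein (ρ 0) (σ 0) := by
  have hmono : Monotone (growthFactor g ε) := fun s t hst =>
    Real.exp_le_exp.2 (mul_le_mul_of_nonneg_left hst (growthRate_nonneg g hε hε'))
  refine ⟨by simp [growthFactor], hmono, fun h s t hst => Real.exp_lt_exp.2
    (mul_lt_mul_of_pos_left hst (growthRate_pos hK.deriv_locallyLipschitz hε hε' h)), ?_⟩
  intro T hT ρ σ hρ hσ
  -- The estimate holds throughout `[0, T)`, so any real time strictly between `0` and `T` can be
  -- chosen.
  obtain ⟨T₁, h0, h1⟩ := EReal.lt_iff_exists_real_btwn.1 hT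
  refine ⟨T₁, EReal.coe_pos.1 h0, h1, ⟨growthFactor g ε T₁, ?_⟩, fun t ht => ?_⟩
  · rintro _ ⟨t, ht, rfl⟩
    exact hmono ht.2.le
  · refine (wasserstein_le_exp_mul_wasserstein hK hε hε' h1 hρ hσ ⟨ht.1, ht.2.le⟩).trans ?_
    refine mul_le_mul_of_nonneg_right (Real.exp_le_exp.2 ?_) (wasserstein_nonneg _ _)
    exact mul_le_mul_of_nonneg_right (two_mul_kernelLip_le_growthRate g hε hε') ht.1
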